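/- Let $\Bbbk$ be a field of characteristic $0$ and $H$ a cocommutative Hopf algebra over $\Bbbk$ with coproduct $\Delta$ and iterated coproducts $\Delta^{(n)}:H\to H^{\otimes n}$ ($\Delta^{(1)}=\mathrm{id}$, $\Delta^{(n+1)}=(\mathrm{id}\otimes\Delta^{(n)})\Delta$). Regard $H^{\otimes n}$ as a right $H$-module via $F\cdot h=F\,\Delta^{(n)}(h)$. Let $P$ be an $H$-pseudoalgebra, i.e. a unital left $H$-module with an $H$-bilinear map $*:P\otimes P\to (H\otimes H)\otimes_H P$, $(fa)*(gb)=(f\otimes g\otimes_H 1)(a*b)$. Extend $*$ to maps $(H^{\otimes n}\otimes_H P)\otimes(H^{\otimes m}\otimes_H P)\to H^{\otimes(n+m)}\otimes_H P$ by $$(F\otimes_H a)*(G\otimes_H b)=(F\otimes G\otimes_H 1)(\Delta^{(n)}\otimes\Delta^{(m)}\otimes_H\mathrm{id})(a*b).$$ For a multilinear non-associative polynomial $f=\sum_{\sigma\in S_n}t_\sigma(x_{1\sigma},\dots,x_{n\sigma})$ over $\Bbbk$, where $t_\sigma(y_1,\dots,y_n)$ is a linear combination of bracketings of $y_1\cdots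 y_n$, put $$f^*(a_1,\dots,a_n)=\sum_{\sigma}(\sigma\otimes_H\mathrm{id})\,t_\sigma^*(a_{1\sigma},\dots,a_{n\sigma})\in H^{\otimes n}\otimes_H P\qquad(a_i\in P),$$ where $t^*_\sigma$ is computed with the extended pseudoproduct and $\sigma$ moves the tensor factor belonging to $a_i$ to the $i$-th position. A pseudoalgebra *satisfies* $f$ if $f^*=0$ identically. With $J(a,b,c)=(ab)c-a(bc)+b(ac)$, a pseudoalgebra is called * *associative* if it satisfies $(ab)c=a(bc)$; * *Lie* if it satisfies $ab=-ba$ and $J(a,b,c)=0$; * *Jordan* if it satisfies $ab=ba$ and the multilinear form of $((aa)b)a=(aa)(ba)$, namely $a(b(cd))+(b(ac))d+c(b(ad))=(ab)(cd)+(ac)(bd)+(cb)(ad)$; * *alternative* if it satisfies the multilinear forms of $(aa)b=a(ab)$ and $a(bb)=(ab)b$, namely $(ab)c+(ba)c=a(bc)+b(ac)$ and $a(bc)+a(cb)=(ab)c+(ac)b$; * *Mal'cev* if it satisfies $ab=-ba$ and the multilinear form of $J(a,b,ac)=J(a,b,c)a$, namely $J(a,b,cd)+J(c,b,ad)=J(a,b,d)c+J(c,b,d)a$.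 Let $P^{(\pm)}$ be the $H$-module $P$ with the pseudoproduct $[a*b]_\pm=a*b\pm(\sigma_{12}\otimes_H\mathrm{id}_P)(b*a)$, where $\sigma_{12}$ is the flip of $H\otimes H$. (i) If $P$ is associative, then $P^{(-)}$ is Lie and $P^{(+)}$ is Jordan. (ii) If $P$ is alternative, then $P^{(-)}$ is Mal'cev and $P^{(+)}$ is Jordan. -/

import Mathlib

open scoped TensorProduct

noncomputable section

namespace Pseudo

/-! ### Extension of scalars `B ⊗_H P` along an algebra homomorphism `δ : H → B`

`B` is a right `H`-module through `b · h = b * δ h`, and `B ⊗_H P` is the quotient of `B ⊗_k P` by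
the relations `(b * δ h) ⊗ p = b ⊗ (h • p)`. It is a left `B`-module. -/

section Ext

variable {k H B B' P E : Type*} [Field k] [Ring H] [Algebra k H] [Ring B] [Algebra k B]
  [Ring B'] [Algebra k B'] [AddCommGroup P] [Module k P] [Module H P]
  [AddCommGroup E] [Module k E]

/-- The relations defining `B ⊗_H P` inside `B ⊗_k P`. -/
def extRel (δ : H →ₐ[k] B) (P : Type*) [AddCommGroup P] [Module k P] [Module H P] :
    Submodule B (B ⊗[k] P) :=
  Submodule.span B {x | ∃ (b : B) (h : H) (p : P), x = (b * δ h) ⊗ₜ[k] p - b ⊗ₜ[k] (h • p)}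

/-- The left `B`-module `B ⊗_H P`, where `H` acts on `B` from the right through `δ : H → B`. -/
def Ext (δ : H →ₐ[k] B) (P : Type*) [AddCommGroup P] [Module k P] [Module H P] : Type _ :=
  (B ⊗[k] P) ⧸ extRel δ P

instance (δ : H →ₐ[k] B) : AddCommGroup (Ext δ P) :=
  inferInstanceAs (AddCommGroup ((B ⊗[k] P) ⧸ extRel δ P))

instance (δ : H →ₐ[k] B) : Module B (Ext δ P) :=
  inferInstanceAs (Module B ((B ⊗[k] P) ⧸ extRel δ P))

instance (δ : H →ₐ[k] B) : Module k (Ext δ P) :=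
  inferInstanceAs (Module k ((B ⊗[k] P) ⧸ extRel δ P))

instance (δ : H →ₐ[k] B) : IsScalarTower k B (Ext δ P) :=
  inferInstanceAs (IsScalarTower k B ((B ⊗[k] P) ⧸ extRel δ P))

/-- The quotient map `B ⊗_k P → B ⊗_H P`. -/
def Ext.proj (δ : H →ₐ[k] B) (P : Type*) [AddCommGroup P] [Module k P] [Module H P] :
    B ⊗[k] P →ₗ[k] Ext δ P :=
  (extRel δ P).mkQ.restrictScalars k

/-- The element `b ⊗_H p`, bilinear in `b` and `p`. -/
def Ext.mk (δ : H →ₐ[k] B) (P : Type*) [AddCommGroup P] [Module k P] [Module H P] :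
    B →ₗ[k] P →ₗ[k] Ext δ P :=
  (TensorProduct.mk k B P).compr₂ (Ext.proj δ P)

theorem Ext.mk_mul (δ : H →ₐ[k] B) (b : B) (h : H) (p : P) :
    Ext.mk δ P (b * δ h) p = Ext.mk δ P b (h • p) :=
  (Submodule.Quotient.eq _).2 (Submodule.subset_span ⟨b, h, p, rfl⟩)

theorem Ext.smul_mk (δ : H →ₐ[k] B) (c b : B) (p : P) :
    c • Ext.mk δ P b p = Ext.mk δ P (c * b) p := rfl

/-- The universal property: an `H`-balanced bilinear map on `B × P` factors through `B ⊗_H P`. -/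
def Ext.lift (δ : H →ₐ[k] B) (f : B →ₗ[k] P →ₗ[k] E)
    (hf : ∀ b h p, f (b * δ h) p = f b (h • p)) : Ext δ P →ₗ[k] E :=
  ((extRel δ P).restrictScalars k).liftQ (TensorProduct.lift f) (by
    have key : ∀ x ∈ extRel δ P, ∀ b : B, TensorProduct.lift f (b • x) = 0 := by
      intro x hx
      induction hx using Submodule.span_induction with
      | mem x hx =>
        obtain ⟨b, h, p, rfl⟩ := hx
        intro c
        rw [smul_sub, TensorProduct.smul_tmul', TensorProduct.smul_tmul', map_sub,
          TensorProduct.lift.tmul, TensorProduct.lift.tmul, smul_eq_mul, smul_eq_mul, ← mul_assoc,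
          hf, sub_self]
      | zero => simp
      | add x y _ _ hx hy => intro b; rw [smul_add, map_add, hx, hy, add_zero]
      | smul c x _ hx => intro b; rw [smul_smul]; exact hx _
    intro x hx
    simpa using key x hx 1) ∘ₗ
  (Submodule.Quotient.restrictScalarsEquiv k (extRel δ P)).symm.toLinearMap

@[simp] theorem Ext.lift_mk (δ : H →ₐ[k] B) (f : B →ₗ[k] P →ₗ[k] E)
    (hf : ∀ b h p, f (b * δ h) p = f b (h • p)) (b : B) (p : P) :
    Ext.lift δ f hf (Ext.mk δ P b p) = f b p := rfl

@[elab_as_elim]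
theorem Ext.induction (δ : H →ₐ[k] B) {motive : Ext δ P → Prop} (x : Ext δ P)
    (mk : ∀ b p, motive (Ext.mk δ P b p))
    (add : ∀ x y, motive x → motive y → motive (x + y)) : motive x := by
  obtain ⟨t, rfl⟩ : ∃ t, Ext.proj δ P t = x := Submodule.mkQ_surjective (extRel δ P) x
  induction t using TensorProduct.induction_on with
  | zero =>
    rw [map_zero]
    have h := mk 0 0
    rwa [map_zero] at h
  | tmul b p => exact mk b p
  | add x y hx hy => rw [map_add]; exact add _ _ hx hy

theorem Ext.hom_ext {δ : H →ₐ[k] B} {f g : Ext δ P →ₗ[k] E}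
    (h : ∀ b p, f (Ext.mk δ P b p) = g (Ext.mk δ P b p)) : f = g := by
  refine LinearMap.ext fun x => ?_
  induction x using Ext.induction with
  | mk b p => exact h b p
  | add x y hx hy => rw [map_add, map_add, hx, hy]

/-- The map `g ⊗_H id : B ⊗_H P → B' ⊗_H P` induced by an algebra homomorphism `g : B → B'`
with `g ∘ δ = δ'`. -/
def Ext.map {δ : H →ₐ[k] B} {δ' : H →ₐ[k] B'} (g : B →ₐ[k] B') (hg : g.comp δ = δ') :
    Ext δ P →ₗ[k] Ext δ' P :=
  Ext.lift δ ((Ext.mk δ' P).comp g.toLinearMap) (by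
    subst hg
    intro b h p
    simpa using Ext.mk_mul (g.comp δ) (g b) h p)

@[simp] theorem Ext.map_mk {δ : H →ₐ[k] B} {δ' : H →ₐ[k] B'} (g : B →ₐ[k] B')
    (hg : g.comp δ = δ') (b : B) (p : P) :
    Ext.map g hg (Ext.mk δ P b p) = Ext.mk δ' P (g b) p := rfl

theorem Ext.map_smul {δ : H →ₐ[k] B} {δ' : H →ₐ[k] B'} (g : B →ₐ[k] B')
    (hg : g.comp δ = δ') (b : B) (x : Ext δ P) :
    Ext.map g hg (b • x) = g b • Ext.map g hg x := by
  induction x using Ext.induction with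
  | mk c p => simp [Ext.smul_mk]
  | add x y hx hy => rw [smul_add, map_add, hx, hy, map_add, smul_add]

end Ext

/-! ### Tensor powers of `H` and the iterated coproduct -/

section Pow

variable (k H : Type*) [Field k] [Ring H]

/-- The algebra `H^{⊗n}`. -/
abbrev Pow [Algebra k H] (n : ℕ) : Type _ := ⨂[k] _i : Fin n, H

variable {k H} in
/-- Relabelling of tensor factors: the factor in position `i` is moved to position `e i`. -/
def Pow.perm [Algebra k H] {m n : ℕ} (e : Fin m ≃ Fin n) : Pow k H m →ₐ[k] Pow k H n :=
  AlgHom.ofLinearMap (PiTensorProduct.reindex k (fun _ => H) e).toLinearMap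
    (by rw [PiTensorProduct.one_def]; exact PiTensorProduct.reindex_tprod e _)
    (LinearMap.map_mul_iff _ |>.mpr <| by
      ext x y
      simp [PiTensorProduct.reindex_tprod, PiTensorProduct.tprod_mul_tprod]
      rfl)

variable {k H} in
@[simp] theorem Pow.perm_tprod [Algebra k H] {m n : ℕ} (e : Fin m ≃ Fin n) (f : Fin m → H) :
    Pow.perm e (PiTensorProduct.tprod k f) = PiTensorProduct.tprod k (fun j => f (e.symm j)) :=
  PiTensorProduct.reindex_tprod e f

variable {H} in
theorem mulEquiv_tprod [Algebra k H] {n m : ℕ} (f : Fin n → H) (g : Fin m → H) :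
    TensorPower.mulEquiv (PiTensorProduct.tprod k f ⊗ₜ[k] PiTensorProduct.tprod k g) =
      PiTensorProduct.tprod k (Fin.append f g) :=
  TensorPower.tprod_mul_tprod k f g

/-- Concatenation `H^{⊗n} ⊗ H^{⊗m} → H^{⊗(n+m)}`. -/
def Pow.concat [Algebra k H] (n m : ℕ) : Pow k H n ⊗[k] Pow k H m →ₐ[k] Pow k H (n + m) :=
  Algebra.TensorProduct.algHomOfLinearMapTensorProduct
    (TensorPower.mulEquiv (R := k) (M := H) (n := n) (m := m)).toLinearMap
    (by
      intro a₁ a₂ b₁ b₂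
      induction a₁ using PiTensorProduct.induction_on with
      | add x y hx hy => simp only [add_mul, TensorProduct.add_tmul, map_add, hx, hy]
      | smul_tprod r a₁ =>
      induction a₂ using PiTensorProduct.induction_on with
      | add x y hx hy => simp only [mul_add, TensorProduct.add_tmul, map_add, hx, hy]
      | smul_tprod s a₂ =>
      induction b₁ using PiTensorProduct.induction_on with
      | add x y hx hy => simp only [add_mul, TensorProduct.tmul_add, map_add, hx, hy]
      | smul_tprod t b₁ =>
      induction b₂ using PiTensorProduct.induction_on with
      | add x y hx hy => simp only [mul_add, TensorProduct.tmul_add, map_add, hx, hy]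
      | smul_tprod u b₂ =>
        have h : Fin.append (a₁ * a₂) (b₁ * b₂) = Fin.append a₁ b₁ * Fin.append a₂ b₂ := by
          funext i
          refine Fin.addCases (fun i => ?_) (fun i => ?_) i <;> simp
        simp only [smul_mul_assoc, mul_smul_comm, PiTensorProduct.tprod_mul_tprod,
          ← TensorProduct.smul_tmul', TensorProduct.tmul_smul, map_smul, LinearEquiv.coe_coe,
          mulEquiv_tprod, h]
        simp only [smul_smul]
        congr 1
        ring)
    (by
      rw [PiTensorProduct.one_def, PiTensorProduct.one_def, PiTensorProduct.one_def,
        LinearEquiv.coe_coe, mulEquiv_tprod]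
      congr 1
      funext i
      refine Fin.addCases (fun i => ?_) (fun i => ?_) i <;> simp)

variable {H} in
@[simp] theorem Pow.concat_tprod [Algebra k H] {n m : ℕ} (f : Fin n → H) (g : Fin m → H) :
    Pow.concat k H n m (PiTensorProduct.tprod k f ⊗ₜ[k] PiTensorProduct.tprod k g) =
      PiTensorProduct.tprod k (Fin.append f g) :=
  mulEquiv_tprod k f g

variable {k H} in
/-- `h ↦ 1 ⊗ ⋯ ⊗ h ⊗ ⋯ ⊗ 1`, with `h` in position `i`. -/
def Pow.single [Algebra k H] {n : ℕ} (i : Fin n) : H →ₐ[k] Pow k H n :=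
  PiTensorProduct.singleAlgHom (A := fun _ : Fin n => H) i

variable {k H} in
theorem Pow.single_apply [Algebra k H] {n : ℕ} (i : Fin n) (h : H) :
    Pow.single (k := k) i h = PiTensorProduct.tprod k (Pi.mulSingle i h : Fin n → H) := rfl

/-- `H ⊗ H^{⊗n} → H^{⊗(n+1)}`, `h ⊗ (f₁ ⊗ ⋯ ⊗ fₙ) ↦ h ⊗ f₁ ⊗ ⋯ ⊗ fₙ`. -/
def Pow.cons [Algebra k H] (n : ℕ) : H ⊗[k] Pow k H n →ₐ[k] Pow k H (n + 1) :=
  ((Pow.perm (finCongr (add_comm 1 n))).comp (Pow.concat k H 1 n)).comp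
    (Algebra.TensorProduct.map (Pow.single (0 : Fin 1)) (AlgHom.id k _))

variable {H} in
@[simp] theorem Pow.cons_tprod [Algebra k H] {n : ℕ} (h : H) (f : Fin n → H) :
    Pow.cons k H n (h ⊗ₜ[k] PiTensorProduct.tprod k f) =
      PiTensorProduct.tprod k (Fin.cons h f : Fin (n + 1) → H) := by
  have h1 : Pow.cons k H n (h ⊗ₜ[k] PiTensorProduct.tprod k f) =
      Pow.perm (finCongr (add_comm 1 n)) (Pow.concat k H 1 n
        (PiTensorProduct.tprod k (Pi.mulSingle (0 : Fin 1) h : Fin 1 → H) ⊗ₜ[k]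
          PiTensorProduct.tprod k f)) := rfl
  rw [h1, Pow.concat_tprod, Pow.perm_tprod]
  congr 1
  funext i
  refine Fin.cases ?_ (fun i => ?_) i
  · have : (finCongr (add_comm 1 n)).symm 0 = Fin.castAdd n (0 : Fin 1) := by ext; simp
    rw [this, Fin.append_left]
    simp
  · have : (finCongr (add_comm 1 n)).symm i.succ = Fin.natAdd 1 i := by
      ext; simp [add_comm]
    rw [this, Fin.append_right]
    simp

variable [Bialgebra k H]

/-- The iterated coproduct `Δ^{(n)} : H → H^{⊗n}`, with `Δ^{(0)} = ε` and
`Δ^{(n+1)} = (id ⊗ Δ^{(n)}) Δ`; in particular `Δ^{(1)} = id`. -/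
def iterComul : (n : ℕ) → (H →ₐ[k] Pow k H n)
  | 0 => (Algebra.ofId k (Pow k H 0)).comp (Bialgebra.counitAlgHom k H)
  | n + 1 => (Pow.cons k H n).comp
      ((Algebra.TensorProduct.map (AlgHom.id k H) (iterComul n)).comp
        (Bialgebra.comulAlgHom k H))

/-- The map `Δ^{(n)} ⊗ Δ^{(m)} : H ⊗ H → H^{⊗(n+m)}`. -/
def iterComulPair (n m : ℕ) : H ⊗[k] H →ₐ[k] Pow k H (n + m) :=
  (Pow.concat k H n m).comp (Algebra.TensorProduct.map (iterComul k H n) (iterComul k H m))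

/-! The iterated coproduct, followed by an algebra homomorphism, is an ordered convolution
product; this yields coassociativity and, for cocommutative `H`, symmetry. -/

open WithConv in
theorem conv_pair {A B : Type*} [Ring A] [Algebra k A] [Ring B] [Algebra k B]
    (φ : H →ₐ[k] B) {B' : Type*} [Ring B'] [Algebra k B'] (φ' : H →ₐ[k] B')
    (ψ : B ⊗[k] B' →ₐ[k] A) :
    toConv ((ψ.comp ((Algebra.TensorProduct.map φ φ').comp
      (Bialgebra.comulAlgHom k H))).toLinearMap) =
    toConv ((ψ.comp (Algebra.TensorProduct.includeLeft.comp φ)).toLinearMap) *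
    toConv ((ψ.comp (Algebra.TensorProduct.includeRight.comp φ')).toLinearMap) := by
  rw [LinearMap.convMul_def]
  congr 1
  ext h
  simp only [AlgHom.toLinearMap_apply, AlgHom.comp_apply, LinearMap.comp_apply,
    Bialgebra.comulAlgHom_apply]
  induction Coalgebra.comul (R := k) h using TensorProduct.induction_on with
  | zero => simp
  | tmul x y => simp [← map_mul]
  | add x y hx hy => simp only [map_add, hx, hy]

open WithConv in
theorem conv_iterComul {A : Type*} [Ring A] [Algebra k A] (n : ℕ) (ψ : Pow k H n →ₐ[k] A) :
    toConv ((ψ.comp (iterComul k H n)).toLinearMap) =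
      (List.ofFn fun i : Fin n =>
        toConv ((ψ.comp (Pow.single i)).toLinearMap)).prod := by
  induction n with
  | zero =>
    rw [List.ofFn_zero, List.prod_nil, LinearMap.convOne_def]
    congr 1
    ext h
    simp [iterComul, Algebra.ofId_apply]
  | succ n ih =>
    have h := conv_pair k H (AlgHom.id k H) (iterComul k H n) (ψ.comp (Pow.cons k H n))
    rw [List.ofFn_succ, List.prod_cons]
    refine h.trans ?_
    rw [← AlgHom.comp_assoc _ Algebra.TensorProduct.includeRight (iterComul k H n), ih]
    congr 3
    · ext h
      have : (1 : Pow k H n) = PiTensorProduct.tprod k (1 : Fin n → H) := rfl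
      have h2 : (Fin.cons h (1 : Fin n → H) : Fin (n + 1) → H) = Pi.mulSingle 0 h := by
        funext i
        refine Fin.cases ?_ (fun i => ?_) i <;> simp
      simp [this, Pow.single_apply, h2]
    · funext i
      congr 2
      ext h
      have h2 : (Fin.cons 1 (Pi.mulSingle i h : Fin n → H) : Fin (n + 1) → H) =
          Pi.mulSingle i.succ h := by
        funext j
        refine Fin.cases ?_ (fun j => ?_) j
        · simp [(Fin.succ_ne_zero i).symm]
        · simp [Pi.mulSingle_apply]
      simp [Pow.single_apply, h2]

theorem iterComulPair_comp_comul (n m : ℕ) :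
    (iterComulPair k H n m).comp (Bialgebra.comulAlgHom k H) = iterComul k H (n + m) := by
  apply AlgHom.toLinearMap_injective
  apply WithConv.toConv_injective
  have h1 := conv_iterComul k H (n + m) (AlgHom.id k _)
  rw [AlgHom.id_comp] at h1
  rw [iterComulPair, AlgHom.comp_assoc, conv_pair, h1, ← AlgHom.comp_assoc, ← AlgHom.comp_assoc,
    conv_iterComul, conv_iterComul, List.ofFn_add, List.prod_append]
  congr 4
  · funext i
    congr 2
    ext h
    have : (1 : Pow k H m) = PiTensorProduct.tprod k (1 : Fin m → H) := rfl
    have h2 : Fin.append (Pi.mulSingle i h : Fin n → H) (1 : Fin m → H) =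
        Pi.mulSingle (Fin.castAdd m i) h := by
      funext j
      refine Fin.addCases (fun j => ?_) (fun j => ?_) j
      · simp [Pi.mulSingle_apply]
      · simp [Pi.mulSingle_apply, Fin.ext_iff]; omega
    simp only [AlgHom.comp_apply, AlgHom.id_apply, Pow.single_apply,
      Algebra.TensorProduct.includeLeft_apply, this, Pow.concat_tprod, h2]
    rfl
  · funext i
    congr 2
    ext h
    have : (1 : Pow k H n) = PiTensorProduct.tprod k (1 : Fin n → H) := rfl
    have h2 : Fin.append (1 : Fin n → H) (Pi.mulSingle i h : Fin m → H) =
        Pi.mulSingle (Fin.natAdd n i) h := by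
      funext j
      refine Fin.addCases (fun j => ?_) (fun j => ?_) j
      · simp [Pi.mulSingle_apply, Fin.ext_iff]; omega
      · simp [Pi.mulSingle_apply]
    simp [this, Pow.single_apply, h2]

variable {k H} in
theorem perm_comp_iterComul [Coalgebra.IsCocomm k H] {m n : ℕ} (e : Fin m ≃ Fin n) :
    (Pow.perm e).comp (iterComul k H m) = iterComul k H n := by
  obtain rfl : m = n := Fin.equiv_iff_eq.1 ⟨e⟩
  apply AlgHom.toLinearMap_injective
  apply WithConv.toConv_injective
  have h1 := conv_iterComul k H m (AlgHom.id k _)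
  rw [AlgHom.id_comp] at h1
  have hs : ∀ i : Fin m, (Pow.perm e).comp (Pow.single (k := k) (H := H) i) =
      (AlgHom.id k _).comp (Pow.single (e i)) := by
    intro i
    ext h
    simp only [AlgHom.comp_apply, AlgHom.id_apply, Pow.single_apply, Pow.perm_tprod]
    congr 1
    funext j
    simp [Pi.mulSingle_apply, Equiv.symm_apply_eq]
  rw [conv_iterComul, h1]
  simp only [hs]
  refine List.Perm.prod_eq' (Equiv.Perm.ofFn_comp_perm e
    (fun i => WithConv.toConv ((AlgHom.id k _).comp (Pow.single (k := k) (H := H) i)).toLinearMap))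
    ?_
  rw [List.pairwise_ofFn]
  intro i j hij
  have hne : e i ≠ e j := fun h => hij.ne (e.injective h)
  rw [Commute, SemiconjBy, LinearMap.convMul_def, LinearMap.convMul_def]
  congr 1
  ext h
  have hc : ∀ x y : H, Pow.single (k := k) (e i) x * Pow.single (e j) y =
      Pow.single (e j) y * Pow.single (e i) x := by
    intro x y
    simp only [Pow.single_apply, PiTensorProduct.tprod_mul_tprod]
    exact congrArg _ (Pi.mulSingle_commute (f := fun _ => H) hne x y)
  simp only [LinearMap.comp_apply]
  conv_lhs => rw [← Coalgebra.comm_comul k h]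
  generalize Coalgebra.comul (R := k) h = t
  induction t using TensorProduct.induction_on with
  | zero => simp
  | tmul x y => simpa using hc y x
  | add x y hx hy => simp only [map_add, hx, hy]

end Pow

/-! ### Non-associative words -/

/-- The sequence of variables of a non-associative word, read from left to right. -/
def leaf {X : Type*} : (w : FreeMagma X) → Fin w.length → X
  | .of x => fun _ => x
  | .mul s t => Fin.append (leaf s) (leaf t)

/-! ### Pseudoproducts -/

section Pseudoalgebra

variable (k H P : Type*) [Field k] [Ring H] [Bialgebra k H] [AddCommGroup P] [Module k P]
  [Module H P]

/-- `(H ⊗ H) ⊗_H P`, where `H` acts on `H ⊗ H` from the right through the coproduct. -/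
abbrev Sq : Type _ := Ext (Bialgebra.comulAlgHom k H) P

/-- `H^{⊗n} ⊗_H P`, where `H` acts on `H^{⊗n}` from the right through `Δ^{(n)}`. -/
abbrev Tens (n : ℕ) : Type _ := Ext (iterComul k H n) P

/-- A pseudoproduct on the left `H`-module `P`: an `H`-bilinear (that is, `H ⊗ H`-linear) map
`* : P ⊗ P → (H ⊗ H) ⊗_H P`. An `H`-pseudoalgebra is a left `H`-module with a pseudoproduct. -/
structure Pseudoproduct where
  mul : P →ₗ[k] P →ₗ[k] Sq k H P
  smul_mul_smul : ∀ (f g : H) (a b : P), mul (f • a) (g • b) = (f ⊗ₜ[k] g : H ⊗[k] H) • mul a b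

variable {k H P}

/-- The flip `σ₁₂ ⊗_H id` of the two tensor factors of `H ⊗ H` in `(H ⊗ H) ⊗_H P`. -/
def swap₁₂ [Coalgebra.IsCocomm k H] : Sq k H P →ₗ[k] Sq k H P :=
  Ext.map (Algebra.TensorProduct.comm k H H).toAlgHom (by
    ext h
    exact Coalgebra.comm_comul k h)

theorem swap₁₂_smul [Coalgebra.IsCocomm k H] (f g : H) (x : Sq k H P) :
    swap₁₂ ((f ⊗ₜ[k] g : H ⊗[k] H) • x) = (g ⊗ₜ[k] f : H ⊗[k] H) • swap₁₂ x :=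
  Ext.map_smul _ _ _ _

/-- The relabelling `e ⊗_H id : H^{⊗m} ⊗_H P → H^{⊗n} ⊗_H P` of tensor factors. -/
def Tens.perm [Coalgebra.IsCocomm k H] {m n : ℕ} (e : Fin m ≃ Fin n) :
    Tens k H P m →ₗ[k] Tens k H P n :=
  Ext.map (Pow.perm e) (perm_comp_iterComul e)

namespace Pseudoproduct

variable (μ : Pseudoproduct k H P)

/-- The pseudoproduct `[a * b]_+ = a * b + (σ₁₂ ⊗_H id)(b * a)`, giving `P^{(+)}`. -/
def plus [Coalgebra.IsCocomm k H] : Pseudoproduct k H P where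
  mul := μ.mul + μ.mul.flip.compr₂ swap₁₂
  smul_mul_smul f g a b := by
    simp [μ.smul_mul_smul, swap₁₂_smul]

/-- The pseudoproduct `[a * b]_- = a * b - (σ₁₂ ⊗_H id)(b * a)`, giving `P^{(-)}`. -/
def minus [Coalgebra.IsCocomm k H] : Pseudoproduct k H P where
  mul := μ.mul - μ.mul.flip.compr₂ swap₁₂
  smul_mul_smul f g a b := by
    simp [μ.smul_mul_smul, swap₁₂_smul, smul_sub]

theorem plus_mul [Coalgebra.IsCocomm k H] (a b : P) :
    μ.plus.mul a b = μ.mul a b + swap₁₂ (μ.mul b a) := rfl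

theorem minus_mul [Coalgebra.IsCocomm k H] (a b : P) :
    μ.minus.mul a b = μ.mul a b - swap₁₂ (μ.mul b a) := rfl

/-- `(Δ^{(n)} ⊗ Δ^{(m)} ⊗_H id)(a * b)`, bilinear in `a` and `b`. -/
def pair (n m : ℕ) : P →ₗ[k] P →ₗ[k] Tens k H P (n + m) :=
  μ.mul.compr₂ (Ext.map (iterComulPair k H n m) (iterComulPair_comp_comul k H n m))

theorem pair_smul_smul (n m : ℕ) (f g : H) (a b : P) :
    μ.pair n m (f • a) (g • b) =
      Pow.concat k H n m (iterComul k H n f ⊗ₜ[k] iterComul k H m g) • μ.pair n m a b := by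
  simp only [pair, LinearMap.compr₂_apply, μ.smul_mul_smul, Ext.map_smul]
  rfl

/-- Auxiliary: `G ⊗_H b ↦ (F ⊗ G ⊗_H 1) (Δ^{(n)} ⊗ Δ^{(m)} ⊗_H id)(a * b)`. -/
def expandedAux {n : ℕ} (m : ℕ) (F : Pow k H n) (a : P) :
    Tens k H P m →ₗ[k] Tens k H P (n + m) :=
  Ext.lift _ (LinearMap.mk₂ k
    (fun (G : Pow k H m) (b : P) => Pow.concat k H n m (F ⊗ₜ[k] G) • μ.pair n m a b)
    (by intros; simp only [TensorProduct.tmul_add, map_add, add_smul])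
    (by intros; simp only [TensorProduct.tmul_smul, map_smul, smul_assoc])
    (by intros; simp only [map_add, smul_add])
    (by intros; simp only [map_smul]; rw [smul_comm]))
    (by
      intro G h b
      have h1 := μ.pair_smul_smul n m 1 h a b
      rw [one_smul, map_one] at h1
      simp only [LinearMap.mk₂_apply, h1, smul_smul, ← map_mul,
        Algebra.TensorProduct.tmul_mul_tmul, mul_one])

theorem expandedAux_mk {n m : ℕ} (F : Pow k H n) (a : P) (G : Pow k H m) (b : P) :
    μ.expandedAux m F a (Ext.mk _ P G b) =
      Pow.concat k H n m (F ⊗ₜ[k] G) • μ.pair n m a b := rfl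

/-- Auxiliary: `expandedAux` as a bilinear map. -/
def expandedAux₂ (n m : ℕ) :
    Pow k H n →ₗ[k] P →ₗ[k] Tens k H P m →ₗ[k] Tens k H P (n + m) :=
  LinearMap.mk₂ k (fun (F : Pow k H n) (a : P) => μ.expandedAux m F a)
    (fun F F' a => Ext.hom_ext fun G b => by
      simp only [expandedAux_mk, LinearMap.add_apply, TensorProduct.add_tmul, map_add, add_smul])
    (fun c F a => Ext.hom_ext fun G b => by
      simp only [expandedAux_mk, LinearMap.smul_apply, ← TensorProduct.smul_tmul', map_smul,
        smul_assoc])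
    (fun F a a' => Ext.hom_ext fun G b => by
      simp only [expandedAux_mk, LinearMap.add_apply, map_add, smul_add])
    (fun c F a => Ext.hom_ext fun G b => by
      simp only [expandedAux_mk, LinearMap.smul_apply, map_smul]
      rw [smul_comm])

theorem expandedAux_mul (n m : ℕ) (F : Pow k H n) (h : H) (a : P) :
    μ.expandedAux m (F * iterComul k H n h) a = μ.expandedAux m F (h • a) := by
  refine Ext.hom_ext fun G b => ?_
  have h1 := μ.pair_smul_smul n m h 1 a b
  rw [one_smul, map_one] at h1
  rw [expandedAux_mk, expandedAux_mk, h1, smul_smul, ← map_mul,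
    Algebra.TensorProduct.tmul_mul_tmul, mul_one]

/-- The expanded pseudoproduct
`(F ⊗_H a) * (G ⊗_H b) = (F ⊗ G ⊗_H 1) (Δ^{(n)} ⊗ Δ^{(m)} ⊗_H id)(a * b)`
of `F ⊗_H a ∈ H^{⊗n} ⊗_H P` and `G ⊗_H b ∈ H^{⊗m} ⊗_H P`. -/
def expanded (n m : ℕ) : Tens k H P n →ₗ[k] Tens k H P m →ₗ[k] Tens k H P (n + m) :=
  Ext.lift _ (μ.expandedAux₂ n m) (μ.expandedAux_mul n m)

theorem expanded_mk_mk {n m : ℕ} (F : Pow k H n) (a : P) (G : Pow k H m) (b : P) :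
    μ.expanded n m (Ext.mk _ P F a) (Ext.mk _ P G b) =
      Pow.concat k H n m (F ⊗ₜ[k] G) • μ.pair n m a b := rfl

/-! ### Pseudo-identities attached to multilinear non-associative polynomials -/

/-- The value of a non-associative word, with multiplication replaced by the expanded
pseudoproduct; the `j`-th tensor factor corresponds to the `j`-th letter of the word. -/
def evalWord {X : Type*} (a : X → P) : (w : FreeMagma X) → Tens k H P w.length
  | .of x => Ext.mk _ P (1 : Pow k H 1) (a x)
  | .mul s t => μ.expanded s.length t.length (evalWord a s) (evalWord a t)

open Classical in
/-- The contribution `(σ ⊗_H id) t^*(a_{1σ}, …, a_{nσ})` of a multilinear word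
`t(x_{1σ}, …, x_{nσ})` in `x_1, …, x_n`: the tensor factor coming from the letter `x_i` is moved to
position `i`. Words that are not multilinear do not occur in multilinear polynomials; they are
given the value `0`. -/
def starWord [Coalgebra.IsCocomm k H] {n : ℕ} (a : Fin n → P) (w : FreeMagma (Fin n)) :
    Tens k H P n :=
  if h : Function.Bijective (leaf w) then Tens.perm (Equiv.ofBijective _ h) (μ.evalWord a w) else 0

/-- The value `f^*(a_1, …, a_n)` of a multilinear polynomial `f`. -/
def starEval [Coalgebra.IsCocomm k H] {n : ℕ} (a : Fin n → P) :
    FreeNonUnitalNonAssocAlgebra k (Fin n) →ₗ[k] Tens k H P n :=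
  (Finsupp.linearCombination k (μ.starWord a)) ∘ₗ
    (MonoidAlgebra.coeffLinearEquiv k).toLinearMap

/-- The pseudo-identity `f^* = 0`. -/
def Satisfies [Coalgebra.IsCocomm k H] {n : ℕ} (f : FreeNonUnitalNonAssocAlgebra k (Fin n)) :
    Prop :=
  ∀ a : Fin n → P, μ.starEval a f = 0

end Pseudoproduct

/-! ### The varieties -/

variable (k)

/-- Non-associative polynomials over `k` in the variables `x_0, …, x_{n-1}`. -/
abbrev Poly (n : ℕ) : Type _ := FreeNonUnitalNonAssocAlgebra k (Fin n)

/-- The variable `x_i`. -/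
abbrev X {n : ℕ} (i : Fin n) : Poly k n := FreeNonUnitalNonAssocAlgebra.of k i

/-- `(x₀ x₁) x₂ - x₀ (x₁ x₂)`. -/
def assocPoly : Poly k 3 := (X k 0 * X k 1) * X k 2 - X k 0 * (X k 1 * X k 2)

/-- `x₀ x₁ - x₁ x₀`. -/
def commPoly : Poly k 2 := X k 0 * X k 1 - X k 1 * X k 0

/-- `x₀ x₁ + x₁ x₀`. -/
def anticommPoly : Poly k 2 := X k 0 * X k 1 + X k 1 * X k 0

variable {k} in
/-- `J(a, b, c) = (a b) c - a (b c) + b (a c)`. -/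
def jacobian {n : ℕ} (a b c : Poly k n) : Poly k n := (a * b) * c - a * (b * c) + b * (a * c)

/-- `J(x₀, x₁, x₂)`. -/
def jacobiPoly : Poly k 3 := jacobian (X k 0) (X k 1) (X k 2)

/-- The multilinear form of the Jordan identity `((a a) b) a = (a a) (b a)`. -/
def jordanPoly : Poly k 4 :=
  X k 0 * (X k 1 * (X k 2 * X k 3)) + (X k 1 * (X k 0 * X k 2)) * X k 3
    + X k 2 * (X k 1 * (X k 0 * X k 3))
  - ((X k 0 * X k 1) * (X k 2 * X k 3) + (X k 0 * X k 2) * (X k 1 * X k 3)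
    + (X k 2 * X k 1) * (X k 0 * X k 3))

/-- The multilinear form of the left alternative identity `(a a) b = a (a b)`. -/
def leftAltPoly : Poly k 3 :=
  (X k 0 * X k 1) * X k 2 + (X k 1 * X k 0) * X k 2
    - (X k 0 * (X k 1 * X k 2) + X k 1 * (X k 0 * X k 2))

/-- The multilinear form of the right alternative identity `a (b b) = (a b) b`. -/
def rightAltPoly : Poly k 3 :=
  X k 0 * (X k 1 * X k 2) + X k 0 * (X k 2 * X k 1)
    - ((X k 0 * X k 1) * X k 2 + (X k 0 * X k 2) * X k 1)

/-- The multilinear form of the Mal'cev identity `J(a, b, a c) = J(a, b, c) a`. -/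
def malcevPoly : Poly k 4 :=
  jacobian (X k 0) (X k 1) (X k 2 * X k 3) + jacobian (X k 2) (X k 1) (X k 0 * X k 3)
    - (jacobian (X k 0) (X k 1) (X k 3) * X k 2 + jacobian (X k 2) (X k 1) (X k 3) * X k 0)

variable {k}

namespace Pseudoproduct

variable [Coalgebra.IsCocomm k H] (μ : Pseudoproduct k H P)

/-- Associative pseudoalgebras. -/
def IsAssociative : Prop := μ.Satisfies (assocPoly k)

/-- Lie pseudoalgebras. -/
def IsLie : Prop := μ.Satisfies (anticommPoly k) ∧ μ.Satisfies (jacobiPoly k)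

/-- Jordan pseudoalgebras. -/
def IsJordan : Prop := μ.Satisfies (commPoly k) ∧ μ.Satisfies (jordanPoly k)

/-- Alternative (left and right alternative) pseudoalgebras. -/
def IsAlternative : Prop := μ.Satisfies (leftAltPoly k) ∧ μ.Satisfies (rightAltPoly k)

/-- Mal'cev pseudoalgebras. -/
def IsMalcev : Prop := μ.Satisfies (anticommPoly k) ∧ μ.Satisfies (malcevPoly k)

end Pseudoproduct
end Pseudoalgebra
end Pseudo
end

/-! The pseudo-identities are reduced to identities in an ordinary non-associative ring. Fix an
assignment `a` of elements of `P` to letters. A word has a value in `H^{⊗n} ⊗_H P`, with one tensor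
factor per letter. Call a combination of words null if the words are rearrangements of one letter
sequence and their values, permuted into the order of that sequence, cancel. Cocommutativity is what
lets permutations act on these tensors. A zero value stays zero after multiplication by anything, so
null elements span a two-sided ideal of the free algebra; its quotient is `evalAlgebra`.

Three facts connect this ring with the pseudoalgebra. Null elements are killed by `starEval`
(`starEval_eq_zero`), because `starEval` sees a combination only through the tensor it represents
(`starEval_eq_arrange`). The quotient inherits associativity or alternativity
(`IsAssociative.evalAlgebra_assoc`, `IsAlternative.evalAlgebra_alternative`). The hypothesis
concerns elements of `P`, whereas words have values in higher tensor powers; but `F ⊗_H a` is `F`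
acting on `(Δ^{(n)} ⊗_H id)(1 ⊗_H a)`, and the expanded product is linear in `F` and natural in
`Δ^{(n)}`, so an identity on `P` spreads to all tensors. Finally, evaluating `f` in `P^{(±)}`
amounts to evaluating in `P` the polynomial obtained by expanding every product of `f` as `s t ± t
s` (`starEval_bracket`).

It remains to use the classical facts that the commutator of an associative ring satisfies the
Jacobi identity, and that in an alternative ring the commutator satisfies the Mal'cev identity and
the anticommutator the Jordan identity. -/

open scoped TensorProduct

noncomputable section

/-! ### Alternative algebras -/

namespace Pseudo

section Alternative

variable {A : Type*} [NonUnitalNonAssocRing A]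

/-- The multilinear forms of the left and right alternative laws. -/
def IsAlternativeAlgebra (A : Type*) [NonUnitalNonAssocRing A] : Prop :=
  (∀ a b c : A, a * b * c + b * a * c = a * (b * c) + b * (a * c)) ∧
    ∀ a b c : A, a * (b * c) + a * (c * b) = a * b * c + a * c * b

/-- The product `a * b + b * a`. -/
def jordanProd (a b : A) : A := a * b + b * a

/-- The product `a * b - b * a`. -/
def commProd (a b : A) : A := a * b - b * a

/-- The Jacobian of the product `a * b - b * a`. -/
def commJacobian (a b c : A) : A :=
  commProd (commProd a b) c - commProd a (commProd b c) + commProd b (commProd a c)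

theorem commJacobian_eq_zero (h : ∀ a b c : A, a * b * c = a * (b * c)) (a b c : A) :
    commJacobian a b c = 0 := by
  simp only [commJacobian, commProd, mul_sub, sub_mul, h]
  abel

theorem IsAlternativeAlgebra.of_assoc (h : ∀ a b c : A, a * b * c = a * (b * c)) :
    IsAlternativeAlgebra A :=
  ⟨fun a b c => by simp only [h], fun a b c => by simp only [h]⟩

-- The identity lies in the additive span of the degree-four consequences of the alternative laws: a
-- product substituted for one variable, or a law multiplied on the right by the fourth variable.
-- The certificate has coefficients `±1`; once it is subtracted, only distributivity and addition
-- are left to check.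
set_option maxHeartbeats 1000000 in
theorem IsAlternativeAlgebra.jordan (hA : IsAlternativeAlgebra A) (a b c d : A) :
    jordanProd a (jordanProd b (jordanProd c d)) + jordanProd (jordanProd b (jordanProd a c)) d
        + jordanProd c (jordanProd b (jordanProd a d)) =
      jordanProd (jordanProd a b) (jordanProd c d) + jordanProd (jordanProd a c) (jordanProd b d)
        + jordanProd (jordanProd c b) (jordanProd a d) := by
  obtain ⟨hL, hR⟩ := hA
  simp only [jordanProd]
  linear_combination (norm := (simp only [mul_add, add_mul]; abel))
    congrArg (· * a) (hR b c d) + hR d (a * c) b + congrArg (· * d) (hR b a c) + hR c (a *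
      d) b + hR a (d * c) b + hR a (c * d) b + hR c (d * a) b + hR d (c * a) b + congrArg (·
      * c) (hR b a d) - hR (d * a) b c - congrArg (· * b) (hL a d c) - hR (b * d) a c - hR
      (c * a) b d - hR (a * c) b d - congrArg (· * b) (hL a c d) - congrArg (· * b) (hL c d
      a) - hR (b * a) c d - hR (d * c) a b - hR (c * d) a b - hR (b * c) a d - hR (a * d) b
      c

-- As for the Jordan identity, the combination below is one solution of a linear system over the
-- integers, whose unknowns weight the degree-four consequences of the two laws. Here left multiples
-- of the laws occur as well. No division is involved.
set_option maxHeartbeats 1000000 in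
theorem IsAlternativeAlgebra.malcev (hA : IsAlternativeAlgebra A) (a b c d : A) :
    commJacobian a b (commProd c d) + commJacobian c b (commProd a d) =
      commProd (commJacobian a b d) c + commProd (commJacobian c b d) a := by
  obtain ⟨hL, hR⟩ := hA
  simp only [commJacobian, commProd]
  linear_combination (norm := (simp only [mul_add, add_mul, mul_sub, sub_mul]; abel))
    (4 : ℤ) • congrArg (· * c) (hL b d a) + (6 : ℤ) • hL (a * c) b d + (6 : ℤ) • hR b (a *
      c) d + (6 : ℤ) • hR (a * c) b d + hL b c (d * a) + (3 : ℤ) • hL (c * d) a b + congrArg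
      (a * ·) (hL b d c) + hL a b (d * c) + congrArg (· * c) (hR a b d) + (3 : ℤ) • hL (d *
      c) a b + (4 : ℤ) • hR (d * c) a b + (6 : ℤ) • hR b (c * a) d + (6 : ℤ) • hR (c * a) b
      d + (6 : ℤ) • hL (c * a) b d + (4 : ℤ) • hL (a * d) c b + (3 : ℤ) • hR (a * d) b c +
      (3 : ℤ) • congrArg (a * ·) (hL c d b) + (6 : ℤ) • hR (b * d) a c + (3 : ℤ) • hL (d *
      a) c b + hL (c * d) b a + hR b (a * d) c + (5 : ℤ) • hL (d * a) b c + (3 : ℤ) •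
      congrArg (· * c) (hR d a b) + (4 : ℤ) • hR (d * a) b c + (5 : ℤ) • hL (d * c) b a + (2
      : ℤ) • congrArg (· * c) (hL a d b) + (2 : ℤ) • hR a (d * c) b + congrArg (c * ·) (hL
      a d b) + (6 : ℤ) • congrArg (· * b) (hL a c d) + (2 : ℤ) • congrArg (a * ·) (hR d b
      c) + (2 : ℤ) • hR c (d * a) b + (2 : ℤ) • hL (a * d) b c + (2 : ℤ) • hR (c * d) a b -
      (2 : ℤ) • congrArg (· * a) (hL c d b) - (4 : ℤ) • congrArg (c * ·) (hR a b d) - hL a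
      b (c * d) - congrArg (a * ·) (hL b c d) - (6 : ℤ) • congrArg (b * ·) (hR d a c) - (5
      : ℤ) • congrArg (· * a) (hR b c d) - congrArg (· * c) (hR b a d) - (3 : ℤ) • congrArg
      (· * a) (hR c b d) - (4 : ℤ) • congrArg (· * a) (hL b c d) - (6 : ℤ) • hL a c (d * b)
      - (3 : ℤ) • congrArg (c * ·) (hL a b d) - hR c (a * d) b - congrArg (· * a) (hR d b
      c) - (2 : ℤ) • hR a (c * d) b - congrArg (c * ·) (hL b d a) - (2 : ℤ) • congrArg (c
      * ·) (hR b a d) - (2 : ℤ) • congrArg (a * ·) (hR c b d)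

end Alternative

/-! ### Functoriality of `B ⊗_H P` in `B`. -/

section ExtMap

variable {k H B B' B'' P : Type*} [Field k] [Ring H] [Algebra k H] [Ring B] [Algebra k B]
  [Ring B'] [Algebra k B'] [Ring B''] [Algebra k B''] [AddCommGroup P] [Module k P] [Module H P]

theorem Ext.map_map {δ : H →ₐ[k] B} {δ' : H →ₐ[k] B'} {δ'' : H →ₐ[k] B''} (g : B →ₐ[k] B')
    (hg : g.comp δ = δ') (g' : B' →ₐ[k] B'') (hg' : g'.comp δ' = δ'') (x : Ext δ P) :
    Ext.map g' hg' (Ext.map g hg x) =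
      Ext.map (g'.comp g) (by rw [AlgHom.comp_assoc, hg, hg']) x := by
  induction x using Ext.induction with
  | mk b p => rfl
  | add x y hx hy => rw [map_add, map_add, map_add, hx, hy]

theorem Ext.map_congr {δ : H →ₐ[k] B} {δ' : H →ₐ[k] B'} {g g' : B →ₐ[k] B'} (h : g = g')
    (hg : g.comp δ = δ') (hg' : g'.comp δ = δ') (x : Ext δ P) :
    Ext.map g hg x = Ext.map g' hg' x := by
  subst h; rfl

theorem Ext.map_id {δ : H →ₐ[k] B} (g : B →ₐ[k] B) (h : g = AlgHom.id k B)
    (hg : g.comp δ = δ) (x : Ext δ P) : Ext.map g hg x = x := by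
  subst h
  induction x using Ext.induction with
  | mk b p => rfl
  | add x y hx hy => rw [map_add, hx, hy]

end ExtMap

/-! ### Tensor products of algebra homomorphisms between tensor powers -/

/-- The block sum of two relabellings. -/
def finSumCongr {m m' n n' : ℕ} (e : Fin m ≃ Fin m') (f : Fin n ≃ Fin n') :
    Fin (m + n) ≃ Fin (m' + n') :=
  finSumFinEquiv.symm.trans ((Equiv.sumCongr e f).trans finSumFinEquiv)

@[simp] theorem finSumCongr_castAdd {m m' n n' : ℕ} (e : Fin m ≃ Fin m') (f : Fin n ≃ Fin n')
    (i : Fin m) : finSumCongr e f (Fin.castAdd n i) = Fin.castAdd n' (e i) := by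
  simp [finSumCongr]

@[simp] theorem finSumCongr_natAdd {m m' n n' : ℕ} (e : Fin m ≃ Fin m') (f : Fin n ≃ Fin n')
    (i : Fin n) : finSumCongr e f (Fin.natAdd m i) = Fin.natAdd m' (f i) := by
  simp [finSumCongr]

section Pow

variable {k H : Type*} [Field k] [Ring H] [Algebra k H]

theorem Pow.concat_algHom_ext {A : Type*} [Ring A] [Algebra k A] {n m : ℕ}
    {f g : Pow k H n ⊗[k] Pow k H m →ₐ[k] A}
    (h : ∀ (x : Fin n → H) (y : Fin m → H),
      f (PiTensorProduct.tprod k x ⊗ₜ PiTensorProduct.tprod k y) =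
        g (PiTensorProduct.tprod k x ⊗ₜ PiTensorProduct.tprod k y)) : f = g := by
  apply AlgHom.toLinearMap_injective
  refine TensorProduct.ext (PiTensorProduct.ext (MultilinearMap.ext fun x =>
    PiTensorProduct.ext (MultilinearMap.ext fun y => h x y)))

theorem Pow.perm_perm {l m n : ℕ} (e : Fin l ≃ Fin m) (f : Fin m ≃ Fin n) (x : Pow k H l) :
    Pow.perm f (Pow.perm e x) = Pow.perm (e.trans f) x := by
  suffices h : ((Pow.perm f).comp (Pow.perm e)).toLinearMap =
      (Pow.perm (k := k) (H := H) (e.trans f)).toLinearMap from LinearMap.congr_fun h x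
  refine PiTensorProduct.ext (MultilinearMap.ext fun x => ?_)
  simp

theorem Pow.perm_refl {n : ℕ} : Pow.perm (k := k) (H := H) (Equiv.refl (Fin n)) =
    AlgHom.id k _ := by
  apply AlgHom.toLinearMap_injective
  refine PiTensorProduct.ext (MultilinearMap.ext fun x => ?_)
  simp

/-- A relabelling that matches the letters of two sequences carries one pure tensor to the
other. -/
theorem Pow.perm_tprod_of {m n : ℕ} (e : Fin m ≃ Fin n) (x : Fin m → H) (y : Fin n → H)
    (h : ∀ i, y (e i) = x i) :
    Pow.perm e (PiTensorProduct.tprod k x) = PiTensorProduct.tprod k y := by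
  rw [Pow.perm_tprod]
  congr 1
  funext j
  rw [← h, e.apply_symm_apply]

theorem Pow.perm_concat {m m' n n' : ℕ} (e : Fin m ≃ Fin m') (f : Fin n ≃ Fin n') :
    (Pow.perm (finSumCongr e f)).comp (Pow.concat k H m n) =
      (Pow.concat k H m' n').comp (Algebra.TensorProduct.map (Pow.perm e) (Pow.perm f)) := by
  refine Pow.concat_algHom_ext fun x y => ?_
  simp only [AlgHom.comp_apply, Algebra.TensorProduct.map_tmul, Pow.concat_tprod]
  rw [Pow.perm_tprod e, Pow.perm_tprod f, Pow.concat_tprod]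
  refine Pow.perm_tprod_of _ _ _ fun i => ?_
  refine Fin.addCases (fun i => ?_) (fun i => ?_) i <;> simp

theorem Pow.perm_flip_concat (m n : ℕ) :
    (Pow.perm finAddFlip).comp (Pow.concat k H m n) =
      (Pow.concat k H n m).comp (Algebra.TensorProduct.comm k _ _).toAlgHom := by
  refine Pow.concat_algHom_ext fun x y => ?_
  have h : (Algebra.TensorProduct.comm k (Pow k H m) (Pow k H n)).toAlgHom
      (PiTensorProduct.tprod k x ⊗ₜ PiTensorProduct.tprod k y) =
        PiTensorProduct.tprod k y ⊗ₜ PiTensorProduct.tprod k x := rfl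
  rw [AlgHom.comp_apply, AlgHom.comp_apply, h, Pow.concat_tprod, Pow.concat_tprod]
  refine Pow.perm_tprod_of (k := k) _ _ _ fun i => ?_
  refine Fin.addCases (fun i => ?_) (fun i => ?_) i <;> simp

variable (k H) in
/-- Concatenation as an isomorphism. -/
def Pow.concatEquiv (n m : ℕ) : Pow k H n ⊗[k] Pow k H m ≃ₐ[k] Pow k H (n + m) :=
  AlgEquiv.ofBijective (Pow.concat k H n m)
    (TensorPower.mulEquiv (R := k) (M := H) (n := n) (m := m)).bijective

/-- The map `θ ⊗ θ' : H^{⊗(n+m)} → H^{⊗(n'+m')}`. -/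
def Pow.tensorHom {n n' m m' : ℕ} (θ : Pow k H n →ₐ[k] Pow k H n')
    (θ' : Pow k H m →ₐ[k] Pow k H m') : Pow k H (n + m) →ₐ[k] Pow k H (n' + m') :=
  ((Pow.concat k H n' m').comp (Algebra.TensorProduct.map θ θ')).comp
    (Pow.concatEquiv k H n m).symm.toAlgHom

theorem Pow.tensorHom_comp_concat {n n' m m' : ℕ} (θ : Pow k H n →ₐ[k] Pow k H n')
    (θ' : Pow k H m →ₐ[k] Pow k H m') :
    (Pow.tensorHom θ θ').comp (Pow.concat k H n m) =
      (Pow.concat k H n' m').comp (Algebra.TensorProduct.map θ θ') := by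
  refine AlgHom.ext fun x => ?_
  exact congrArg ((Pow.concat k H n' m').comp (Algebra.TensorProduct.map θ θ'))
    ((Pow.concatEquiv k H n m).symm_apply_apply x)

@[simp] theorem Pow.tensorHom_concat {n n' m m' : ℕ} (θ : Pow k H n →ₐ[k] Pow k H n')
    (θ' : Pow k H m →ₐ[k] Pow k H m') (F : Pow k H n) (G : Pow k H m) :
    Pow.tensorHom θ θ' (Pow.concat k H n m (F ⊗ₜ G)) =
      Pow.concat k H n' m' (θ F ⊗ₜ θ' G) :=
  DFunLike.congr_fun (Pow.tensorHom_comp_concat θ θ') (F ⊗ₜ G)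

theorem Pow.concat_surjective (n m : ℕ) : Function.Surjective (Pow.concat k H n m) :=
  (Pow.concatEquiv k H n m).surjective

theorem Pow.algHom_ext_concat {A : Type*} [Ring A] [Algebra k A] {n m : ℕ}
    {f g : Pow k H (n + m) →ₐ[k] A}
    (h : ∀ (F : Pow k H n) (G : Pow k H m),
      f (Pow.concat k H n m (F ⊗ₜ G)) = g (Pow.concat k H n m (F ⊗ₜ G))) : f = g := by
  refine (AlgHom.cancel_right (Pow.concat_surjective n m)).1 ?_
  exact Pow.concat_algHom_ext fun x y => h (PiTensorProduct.tprod k x) (PiTensorProduct.tprod k y)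

theorem Pow.perm_finSumCongr {m m' n n' : ℕ} (e : Fin m ≃ Fin m') (f : Fin n ≃ Fin n') :
    Pow.perm (k := k) (H := H) (finSumCongr e f) = Pow.tensorHom (Pow.perm e) (Pow.perm f) :=
  Pow.algHom_ext_concat fun F G => by
    rw [Pow.tensorHom_concat]
    exact DFunLike.congr_fun (Pow.perm_concat (k := k) (H := H) e f) (F ⊗ₜ G)

/-- The pure concatenation `F ⊗ G ⊗ K`. -/
def Pow.concat₃ {p q r : ℕ} (F : Pow k H p) (G : Pow k H q) (K : Pow k H r) :
    Pow k H (p + q + r) :=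
  Pow.concat k H (p + q) r (Pow.concat k H p q (F ⊗ₜ G) ⊗ₜ K)

/-- Pure concatenations span, so naturality of block permutations can be tested on them. -/
theorem Pow.algHom_ext_concat₃ {A : Type*} [Ring A] [Algebra k A] {p q r : ℕ}
    {f g : Pow k H (p + q + r) →ₐ[k] A}
    (h : ∀ F G K, f (Pow.concat₃ F G K) = g (Pow.concat₃ F G K)) : f = g := by
  refine Pow.algHom_ext_concat fun F K => ?_
  obtain ⟨t, rfl⟩ := Pow.concat_surjective p q F
  induction t using TensorProduct.induction_on with
  | zero => simp
  | tmul x y => exact h x y K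
  | add x y hx hy => simp only [map_add, TensorProduct.add_tmul, hx, hy]

theorem Pow.algHom_ext_concat₃' {A : Type*} [Ring A] [Algebra k A] {p q r : ℕ}
    {f g : Pow k H (p + (q + r)) →ₐ[k] A}
    (h : ∀ F G K, f (Pow.concat k H p (q + r) (F ⊗ₜ Pow.concat k H q r (G ⊗ₜ K))) =
      g (Pow.concat k H p (q + r) (F ⊗ₜ Pow.concat k H q r (G ⊗ₜ K)))) : f = g := by
  refine Pow.algHom_ext_concat fun F K => ?_
  obtain ⟨t, rfl⟩ := Pow.concat_surjective q r K
  induction t using TensorProduct.induction_on with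
  | zero => simp
  | tmul x y => exact h F x y
  | add x y hx hy => simp only [map_add, TensorProduct.tmul_add, hx, hy]

/-- Rebracketing of three blocks. -/
def finAssoc (p q r : ℕ) : Fin (p + (q + r)) ≃ Fin (p + q + r) := finCongr (add_assoc p q r).symm

/-- Exchange of the first two of three blocks. -/
def finFlip₁₂ (q p r : ℕ) : Fin (q + p + r) ≃ Fin (p + q + r) :=
  finSumCongr finAddFlip (Equiv.refl _)

/-- Exchange of the last two of three blocks. -/
def finFlip₂₃ (p r q : ℕ) : Fin (p + r + q) ≃ Fin (p + q + r) :=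
  (finAssoc p r q).symm.trans ((finSumCongr (Equiv.refl _) finAddFlip).trans (finAssoc p q r))

/-! ### Block permutations acting on letter sequences. -/

section append

variable {X : Type*} {p q r : ℕ} (x : Fin p → X) (y : Fin q → X) (z : Fin r → X)

theorem append_comp_finSumCongr {p' q' : ℕ} (e : Fin p ≃ Fin p') (f : Fin q ≃ Fin q')
    {x' : Fin p' → X} {y' : Fin q' → X} (hx : ∀ i, x' (e i) = x i) (hy : ∀ i, y' (f i) = y i)
    (i : Fin (p + q)) : Fin.append x' y' (finSumCongr e f i) = Fin.append x y i := by
  refine Fin.addCases (fun i => ?_) (fun i => ?_) i <;> simp [hx, hy]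

theorem append_comp_finAddFlip (i : Fin (p + q)) :
    Fin.append y x (finAddFlip i) = Fin.append x y i := by
  refine Fin.addCases (fun i => ?_) (fun i => ?_) i <;> simp

theorem append_comp_finAssoc (i : Fin (p + (q + r))) :
    Fin.append (Fin.append x y) z (finAssoc p q r i) = Fin.append x (Fin.append y z) i := by
  rw [Fin.append_assoc]
  rfl

theorem append_comp_finFlip₁₂ (i : Fin (q + p + r)) :
    Fin.append (Fin.append x y) z (finFlip₁₂ q p r i) = Fin.append (Fin.append y x) z i :=
  append_comp_finSumCongr _ _ _ _ (append_comp_finAddFlip _ _) (fun _ => rfl) i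

theorem append_comp_finFlip₂₃ (i : Fin (p + r + q)) :
    Fin.append (Fin.append x y) z (finFlip₂₃ p r q i) = Fin.append (Fin.append x z) y i := by
  obtain ⟨i, rfl⟩ := (finAssoc p r q).surjective i
  rw [finFlip₂₃, Equiv.trans_apply, Equiv.symm_apply_apply, Equiv.trans_apply,
    append_comp_finAssoc, append_comp_finAssoc]
  exact append_comp_finSumCongr _ _ _ _ (fun _ => rfl) (append_comp_finAddFlip _ _) i

end append

theorem Pow.induction_tprod {n : ℕ} {motive : Pow k H n → Prop} (F : Pow k H n)
    (tprod : ∀ x : Fin n → H, motive (PiTensorProduct.tprod k x))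
    (smul : ∀ (c : k) F, motive F → motive (c • F))
    (add : ∀ F G, motive F → motive G → motive (F + G)) : motive F := by
  induction F using PiTensorProduct.induction_on with
  | smul_tprod c x => exact smul c _ (tprod x)
  | add F G hF hG => exact add F G hF hG

theorem Pow.concat₃_tprod {p q r : ℕ} (x : Fin p → H) (y : Fin q → H) (z : Fin r → H) :
    Pow.concat₃ (PiTensorProduct.tprod k x) (PiTensorProduct.tprod k y)
      (PiTensorProduct.tprod k z) =
        PiTensorProduct.tprod k (Fin.append (Fin.append x y) z) := by
  rw [Pow.concat₃, Pow.concat_tprod, Pow.concat_tprod]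

theorem Pow.perm_finAssoc {p q r : ℕ} (F : Pow k H p) (G : Pow k H q) (K : Pow k H r) :
    Pow.perm (finAssoc p q r) (Pow.concat k H p (q + r) (F ⊗ₜ Pow.concat k H q r (G ⊗ₜ K))) =
      Pow.concat₃ F G K := by
  induction F using Pow.induction_tprod with
  | add F F' h h' => simp only [Pow.concat₃, TensorProduct.add_tmul, map_add] at h h' ⊢; rw [h, h']
  | smul c F h => simp only [Pow.concat₃, ← TensorProduct.smul_tmul', map_smul] at h ⊢; rw [h]
  | tprod x =>
  induction G using Pow.induction_tprod with
  | add F F' h h' =>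
    simp only [Pow.concat₃, TensorProduct.add_tmul, TensorProduct.tmul_add, map_add] at h h' ⊢
    rw [h, h']
  | smul c F h =>
    simp only [Pow.concat₃, ← TensorProduct.smul_tmul', TensorProduct.tmul_smul, map_smul] at h ⊢
    rw [h]
  | tprod y =>
  induction K using Pow.induction_tprod with
  | add F F' h h' => simp only [Pow.concat₃, TensorProduct.tmul_add, map_add] at h h' ⊢; rw [h, h']
  | smul c F h => simp only [Pow.concat₃, TensorProduct.tmul_smul, map_smul] at h ⊢; rw [h]
  | tprod z =>
    rw [Pow.concat_tprod, Pow.concat_tprod, Pow.concat₃_tprod]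
    exact Pow.perm_tprod_of _ _ _ (append_comp_finAssoc x y z)

theorem Pow.perm_finAddFlip {p q : ℕ} (F : Pow k H p) (G : Pow k H q) :
    Pow.perm finAddFlip (Pow.concat k H p q (F ⊗ₜ G)) = Pow.concat k H q p (G ⊗ₜ F) :=
  DFunLike.congr_fun (Pow.perm_flip_concat (k := k) (H := H) p q) (F ⊗ₜ G)

theorem Pow.perm_finFlip₁₂ {p q r : ℕ} (F : Pow k H p) (G : Pow k H q) (K : Pow k H r) :
    Pow.perm (finFlip₁₂ q p r) (Pow.concat₃ G F K) = Pow.concat₃ F G K := by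
  rw [finFlip₁₂, Pow.perm_finSumCongr, Pow.concat₃, Pow.tensorHom_concat, Pow.perm_finAddFlip,
    Pow.perm_refl]
  rfl

theorem Pow.perm_finFlip₂₃ {p q r : ℕ} (F : Pow k H p) (G : Pow k H q) (K : Pow k H r) :
    Pow.perm (finFlip₂₃ p r q) (Pow.concat₃ F K G) = Pow.concat₃ F G K := by
  -- After rebracketing, the last two blocks form one factor, and the flip acts inside it.
  rw [← Pow.perm_finAssoc, ← Pow.perm_finAssoc, Pow.perm_perm, finFlip₂₃, ← Equiv.trans_assoc,
    Equiv.self_trans_symm, Equiv.refl_trans, ← Pow.perm_perm, Pow.perm_finSumCongr,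
    Pow.tensorHom_concat, Pow.perm_finAddFlip, Pow.perm_refl]
  rfl

end Pow

/-! ### Coassociativity and naturality for the iterated coproducts. -/

section Pow

variable {k H : Type*} [Field k] [Ring H] [Bialgebra k H]

theorem tensorHom_comp_iterComulPair {n n' m m' : ℕ} {θ : Pow k H n →ₐ[k] Pow k H n'}
    {θ' : Pow k H m →ₐ[k] Pow k H m'} (hθ : θ.comp (iterComul k H n) = iterComul k H n')
    (hθ' : θ'.comp (iterComul k H m) = iterComul k H m') :
    (Pow.tensorHom θ θ').comp (iterComulPair k H n m) = iterComulPair k H n' m' := by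
  rw [iterComulPair, iterComulPair, ← AlgHom.comp_assoc, Pow.tensorHom_comp_concat,
    AlgHom.comp_assoc, ← Algebra.TensorProduct.map_comp, hθ, hθ']

/-- Generalized coassociativity: `Δ^{(n+m)}` is `Δ^{(n)} ⊗ Δ^{(m)}` after `Δ`, so maps compatible
with the two factors tensor to a compatible map. This makes `Ext.map` available for `θ ⊗ θ'`. -/
theorem tensorHom_comp_iterComul {n n' m m' : ℕ} {θ : Pow k H n →ₐ[k] Pow k H n'}
    {θ' : Pow k H m →ₐ[k] Pow k H m'} (hθ : θ.comp (iterComul k H n) = iterComul k H n')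
    (hθ' : θ'.comp (iterComul k H m) = iterComul k H m') :
    (Pow.tensorHom θ θ').comp (iterComul k H (n + m)) = iterComul k H (n' + m') := by
  rw [← iterComulPair_comp_comul, ← iterComulPair_comp_comul, ← AlgHom.comp_assoc,
    tensorHom_comp_iterComulPair hθ hθ']

/-- The identification `H^{⊗1} = H`. -/
def Pow.toSelf : Pow k H 1 →ₐ[k] H :=
  PiTensorProduct.liftAlgHom (MultilinearMap.ofSubsingleton k H H (0 : Fin 1) LinearMap.id)
    (by simp) (by simp)

/-- The recursion defines `Δ^{(1)}` through the counit, so this is not definitional. The convolution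
product that computes it has a single factor, which `Pow.toSelf` undoes. -/
theorem Pow.toSelf_comp_iterComul : (Pow.toSelf (k := k) (H := H)).comp (iterComul k H 1) =
    AlgHom.id k H := by
  apply AlgHom.toLinearMap_injective
  apply WithConv.toConv_injective
  rw [conv_iterComul, List.ofFn_succ, List.ofFn_zero, List.prod_singleton]
  congr 2
  ext h
  simp [Pow.toSelf, Pow.single_apply]

variable (k H) in
/-- The iterated coproduct as a map `H^{⊗1} → H^{⊗n}`. -/
def iterComulOne (n : ℕ) : Pow k H 1 →ₐ[k] Pow k H n := (iterComul k H n).comp Pow.toSelf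

theorem iterComulOne_comp_iterComul (n : ℕ) :
    (iterComulOne k H n).comp (iterComul k H 1) = iterComul k H n := by
  rw [iterComulOne, AlgHom.comp_assoc, Pow.toSelf_comp_iterComul, AlgHom.comp_id]

variable (k H) in
/-- The map `Δ^{(p)} ⊗ Δ^{(q)} ⊗ Δ^{(r)}`. -/
def iterComulTriple (p q r : ℕ) : Pow k H (1 + 1 + 1) →ₐ[k] Pow k H (p + q + r) :=
  Pow.tensorHom (Pow.tensorHom (iterComulOne k H p) (iterComulOne k H q)) (iterComulOne k H r)

theorem iterComulTriple_comp_iterComul (p q r : ℕ) :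
    (iterComulTriple k H p q r).comp (iterComul k H (1 + 1 + 1)) = iterComul k H (p + q + r) :=
  tensorHom_comp_iterComul (tensorHom_comp_iterComul (iterComulOne_comp_iterComul p)
    (iterComulOne_comp_iterComul q)) (iterComulOne_comp_iterComul r)

theorem iterComulTriple_concat₃ (p q r : ℕ) (F G K : Pow k H 1) :
    iterComulTriple k H p q r (Pow.concat₃ F G K) =
      Pow.concat₃ (iterComulOne k H p F) (iterComulOne k H q G) (iterComulOne k H r K) := by
  rw [iterComulTriple, Pow.concat₃, Pow.tensorHom_concat, Pow.tensorHom_concat, Pow.concat₃]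

/-- Naturality: exchanging blocks after expanding each factor is the same as exchanging the single
factors first. -/
theorem perm_finFlip₁₂_comp_iterComulTriple (p q r : ℕ) :
    (Pow.perm (finFlip₁₂ q p r)).comp (iterComulTriple k H q p r) =
      (iterComulTriple k H p q r).comp (Pow.perm (finFlip₁₂ 1 1 1)) :=
  Pow.algHom_ext_concat₃ fun F G K => by
    rw [AlgHom.comp_apply, AlgHom.comp_apply, iterComulTriple_concat₃, Pow.perm_finFlip₁₂,
      Pow.perm_finFlip₁₂, iterComulTriple_concat₃]

theorem perm_finFlip₂₃_comp_iterComulTriple (p q r : ℕ) :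
    (Pow.perm (finFlip₂₃ p r q)).comp (iterComulTriple k H p r q) =
      (iterComulTriple k H p q r).comp (Pow.perm (finFlip₂₃ 1 1 1)) :=
  Pow.algHom_ext_concat₃ fun F G K => by
    rw [AlgHom.comp_apply, AlgHom.comp_apply, iterComulTriple_concat₃, Pow.perm_finFlip₂₃,
      Pow.perm_finFlip₂₃, iterComulTriple_concat₃]

theorem perm_finAssoc_comp_tensorHom (p q r : ℕ) :
    (Pow.perm (finAssoc p q r)).comp (Pow.tensorHom (iterComulOne k H p)
        (Pow.tensorHom (iterComulOne k H q) (iterComulOne k H r))) =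
      (iterComulTriple k H p q r).comp (Pow.perm (finAssoc 1 1 1)) :=
  Pow.algHom_ext_concat₃' fun F G K => by
    rw [AlgHom.comp_apply, AlgHom.comp_apply, Pow.tensorHom_concat, Pow.tensorHom_concat,
      Pow.perm_finAssoc, Pow.perm_finAssoc, iterComulTriple_concat₃]

theorem iterComulPair_comp_comm (n m : ℕ) :
    (iterComulPair k H n m).comp (Algebra.TensorProduct.comm k H H).toAlgHom =
      (Pow.perm finAddFlip).comp (iterComulPair k H m n) := by
  refine Algebra.TensorProduct.ext' fun x y => ?_
  exact (Pow.perm_finAddFlip (iterComul k H m x) (iterComul k H n y)).symm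

end Pow

/-! ### Naturality and linearity of the expanded pseudoproduct. -/

section Pseudoalgebra

variable {k H P : Type*} [Field k] [Ring H] [Bialgebra k H] [AddCommGroup P] [Module k P]
  [Module H P]

section Perm

variable [Coalgebra.IsCocomm k H]

theorem Tens.perm_perm {l m n : ℕ} (e : Fin l ≃ Fin m) (f : Fin m ≃ Fin n) (x : Tens k H P l) :
    Tens.perm f (Tens.perm e x) = Tens.perm (e.trans f) x :=
  (Ext.map_map _ _ _ _ x).trans (Ext.map_congr (AlgHom.ext fun x => Pow.perm_perm e f x) _ _ x)

theorem Tens.perm_refl {n : ℕ} (x : Tens k H P n) : Tens.perm (Equiv.refl _) x = x :=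
  Ext.map_id _ Pow.perm_refl _ x

theorem Tens.perm_smul {m n : ℕ} (e : Fin m ≃ Fin n) (F : Pow k H m) (x : Tens k H P m) :
    Tens.perm e (F • x) = Pow.perm e F • Tens.perm e x :=
  Ext.map_smul _ _ _ _

theorem Tens.perm_map {m n m' n' : ℕ} (e : Fin m ≃ Fin n) (f : Fin m' ≃ Fin n')
    {g : Pow k H m' →ₐ[k] Pow k H m} (hg : g.comp (iterComul k H m') = iterComul k H m)
    {g' : Pow k H n' →ₐ[k] Pow k H n} (hg' : g'.comp (iterComul k H n') = iterComul k H n)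
    (h : (Pow.perm e).comp g = g'.comp (Pow.perm f)) (x : Tens k H P m') :
    Tens.perm e (Ext.map g hg x) = Ext.map g' hg' (Tens.perm f x) := by
  rw [Tens.perm, Tens.perm, Ext.map_map, Ext.map_map]
  exact Ext.map_congr h _ _ x

end Perm

namespace Pseudoproduct

variable (μ : Pseudoproduct k H P)

theorem expanded_map_map {n n' m m' : ℕ} {θ : Pow k H n →ₐ[k] Pow k H n'}
    {θ' : Pow k H m →ₐ[k] Pow k H m'} (hθ : θ.comp (iterComul k H n) = iterComul k H n')
    (hθ' : θ'.comp (iterComul k H m) = iterComul k H m') (x : Tens k H P n) (y : Tens k H P m) :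
    μ.expanded n' m' (Ext.map θ hθ x) (Ext.map θ' hθ' y) =
      Ext.map (Pow.tensorHom θ θ') (tensorHom_comp_iterComul hθ hθ') (μ.expanded n m x y) := by
  induction x using Ext.induction with
  | add x x' h h' => simp only [map_add, LinearMap.add_apply, h, h']
  | mk F a =>
  induction y using Ext.induction with
  | add x x' h h' => simp only [map_add, h, h']
  | mk G b =>
  rw [Ext.map_mk, Ext.map_mk, expanded_mk_mk, expanded_mk_mk, Ext.map_smul, Pow.tensorHom_concat]
  congr 1
  refine Eq.trans ?_ (Ext.map_map _ (iterComulPair_comp_comul k H n m) _ _ (μ.mul a b)).symm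
  exact Ext.map_congr (tensorHom_comp_iterComulPair hθ hθ').symm
    (iterComulPair_comp_comul k H n' m') _ _

/-- Together with `expanded_map_map`, this reduces products of arbitrary tensors to products of
elements `1 ⊗_H a`. -/
theorem expanded_smul_smul {n m : ℕ} (F : Pow k H n) (G : Pow k H m) (x : Tens k H P n)
    (y : Tens k H P m) :
    μ.expanded n m (F • x) (G • y) = Pow.concat k H n m (F ⊗ₜ G) • μ.expanded n m x y := by
  induction x using Ext.induction with
  | add x x' h h' => simp only [smul_add, map_add, LinearMap.add_apply, h, h']
  | mk F a =>
  induction y using Ext.induction with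
  | add x x' h h' => simp only [smul_add, map_add, h, h']
  | mk G b =>
  rw [Ext.smul_mk, Ext.smul_mk, expanded_mk_mk, expanded_mk_mk, smul_smul, ← map_mul,
    Algebra.TensorProduct.tmul_mul_tmul]

/-! ### Products of three factors -/

/-- The product `(x * y) * z`. -/
def leftTriple {p q r : ℕ} (x : Tens k H P p) (y : Tens k H P q) (z : Tens k H P r) :
    Tens k H P (p + q + r) :=
  μ.expanded (p + q) r (μ.expanded p q x y) z

variable (k H) in
/-- The element `1 ⊗_H a`. -/
abbrev _root_.Pseudo.Tens.one (a : P) : Tens k H P 1 := Ext.mk (iterComul k H 1) P 1 a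

/-- The decomposition that carries identities from `P` to all tensors: every generator comes from an
element of `P` by a coproduct followed by a left multiplication, and both operations pass through
products. -/
theorem _root_.Pseudo.Tens.mk_eq_smul_map {n : ℕ} (F : Pow k H n) (a : P) :
    Ext.mk (iterComul k H n) P F a =
      F • Ext.map (iterComulOne k H n) (iterComulOne_comp_iterComul n) (Tens.one k H a) := by
  rw [Ext.map_mk, Ext.smul_mk, map_one, mul_one]

/-- The map `Δ^{(p)} ⊗ Δ^{(q)} ⊗ Δ^{(r)} ⊗_H id`, followed by the action of `F ⊗ G ⊗ K`. -/
def tripleMap {p q r : ℕ} (F : Pow k H p) (G : Pow k H q) (K : Pow k H r)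
    (x : Tens k H P (1 + 1 + 1)) : Tens k H P (p + q + r) :=
  Pow.concat₃ F G K • Ext.map (iterComulTriple k H p q r) (iterComulTriple_comp_iterComul p q r) x

theorem tripleMap_add {p q r : ℕ} (F : Pow k H p) (G : Pow k H q) (K : Pow k H r)
    (x y : Tens k H P (1 + 1 + 1)) :
    tripleMap F G K (x + y) = tripleMap F G K x + tripleMap F G K y := by
  simp only [tripleMap, map_add, smul_add]

theorem leftTriple_mk {p q r : ℕ} (F : Pow k H p) (G : Pow k H q) (K : Pow k H r) (a b c : P) :
    μ.leftTriple (Ext.mk _ P F a) (Ext.mk _ P G b) (Ext.mk _ P K c) =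
      tripleMap F G K (μ.leftTriple (Tens.one k H a) (Tens.one k H b) (Tens.one k H c)) := by
  rw [leftTriple, Tens.mk_eq_smul_map F, Tens.mk_eq_smul_map G, Tens.mk_eq_smul_map K,
    expanded_smul_smul, expanded_smul_smul, expanded_map_map, expanded_map_map]
  rfl

/-- Induction for statements that are additive in three tensors. -/
theorem _root_.Pseudo.Tens.induction₃
    {motive : ∀ {p q r : ℕ}, Tens k H P p → Tens k H P q → Tens k H P r → Prop} {p q r : ℕ}
    (x : Tens k H P p) (y : Tens k H P q) (z : Tens k H P r)
    (mk : ∀ F a G b K c, motive (p := p) (q := q) (r := r)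
      (Ext.mk _ P F a) (Ext.mk _ P G b) (Ext.mk _ P K c))
    (add₁ : ∀ (x x' : Tens k H P p) (y : Tens k H P q) (z : Tens k H P r),
      motive x y z → motive x' y z → motive (x + x') y z)
    (add₂ : ∀ (x : Tens k H P p) (y y' : Tens k H P q) (z : Tens k H P r),
      motive x y z → motive x y' z → motive x (y + y') z)
    (add₃ : ∀ (x : Tens k H P p) (y : Tens k H P q) (z z' : Tens k H P r),
      motive x y z → motive x y z' → motive x y (z + z')) : motive x y z := by
  induction x using Ext.induction with
  | add x x' h h' => exact add₁ _ _ _ _ h h'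
  | mk F a =>
  induction y using Ext.induction with
  | add x x' h h' => exact add₂ _ _ _ _ h h'
  | mk G b =>
  induction z using Ext.induction with
  | add x x' h h' => exact add₃ _ _ _ _ h h'
  | mk K c => exact mk F a G b K c

section Perm

variable [Coalgebra.IsCocomm k H]

theorem expanded_perm_perm {n n' m m' : ℕ} (e : Fin n ≃ Fin n') (f : Fin m ≃ Fin m')
    (x : Tens k H P n) (y : Tens k H P m) :
    μ.expanded n' m' (Tens.perm e x) (Tens.perm f y) =
      Tens.perm (finSumCongr e f) (μ.expanded n m x y) :=
  (μ.expanded_map_map _ _ x y).trans (Ext.map_congr (Pow.perm_finSumCongr e f).symm _ _ _)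

/-- If `[a * b] = a * b + ε (σ₁₂ ⊗_H id)(b * a)`, then the expanded pseudoproducts are related in
the same way. -/
theorem expanded_eq_add_flip {ν : Pseudoproduct k H P} {ε : k}
    (h : ∀ a b, ν.mul a b = μ.mul a b + ε • swap₁₂ (μ.mul b a)) {n m : ℕ}
    (x : Tens k H P n) (y : Tens k H P m) :
    ν.expanded n m x y = μ.expanded n m x y + ε • Tens.perm finAddFlip (μ.expanded m n y x) := by
  induction x using Ext.induction with
  | add x x' h h' => simp only [map_add, LinearMap.add_apply, h, h', smul_add]; abel
  | mk F a =>
  induction y using Ext.induction with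
  | add x x' h h' => simp only [map_add, LinearMap.add_apply, h, h', smul_add]; abel
  | mk G b =>
  -- Flipping the two factors and then expanding them equals expanding in the other order and then
  -- flipping the blocks.
  have h1 : Ext.map (iterComulPair k H n m) (iterComulPair_comp_comul k H n m)
      (swap₁₂ (μ.mul b a)) = Tens.perm finAddFlip (μ.pair m n b a) := by
    refine (Ext.map_map _ _ _ _ _).trans
      (Eq.trans ?_ (Ext.map_map _ (iterComulPair_comp_comul k H m n) _ _ _).symm)
    exact Ext.map_congr (iterComulPair_comp_comm n m) _ _ _
  rw [expanded_mk_mk, expanded_mk_mk, expanded_mk_mk, Tens.perm_smul, Pow.perm_finAddFlip, ← h1,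
    smul_comm ε, ← smul_add]
  congr 1
  rw [pair, LinearMap.compr₂_apply, h, map_add, map_smul]
  rfl

/-- The product `x * (y * z)`. -/
def rightTriple {p q r : ℕ} (x : Tens k H P p) (y : Tens k H P q) (z : Tens k H P r) :
    Tens k H P (p + q + r) :=
  Tens.perm (finAssoc p q r) (μ.expanded p (q + r) x (μ.expanded q r y z))

theorem perm_finFlip₁₂_tripleMap {p q r : ℕ} (F : Pow k H p) (G : Pow k H q) (K : Pow k H r)
    (x : Tens k H P (1 + 1 + 1)) :
    Tens.perm (finFlip₁₂ q p r) (tripleMap G F K x) =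
      tripleMap F G K (Tens.perm (finFlip₁₂ 1 1 1) x) := by
  rw [tripleMap, Tens.perm_smul, Pow.perm_finFlip₁₂, Tens.perm_map _ _ _
    (iterComulTriple_comp_iterComul p q r) (perm_finFlip₁₂_comp_iterComulTriple p q r)]
  rfl

theorem perm_finFlip₂₃_tripleMap {p q r : ℕ} (F : Pow k H p) (G : Pow k H q) (K : Pow k H r)
    (x : Tens k H P (1 + 1 + 1)) :
    Tens.perm (finFlip₂₃ p r q) (tripleMap F K G x) =
      tripleMap F G K (Tens.perm (finFlip₂₃ 1 1 1) x) := by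
  rw [tripleMap, Tens.perm_smul, Pow.perm_finFlip₂₃, Tens.perm_map _ _ _
    (iterComulTriple_comp_iterComul p q r) (perm_finFlip₂₃_comp_iterComulTriple p q r)]
  rfl

theorem rightTriple_mk {p q r : ℕ} (F : Pow k H p) (G : Pow k H q) (K : Pow k H r) (a b c : P) :
    μ.rightTriple (Ext.mk _ P F a) (Ext.mk _ P G b) (Ext.mk _ P K c) =
      tripleMap F G K (μ.rightTriple (Tens.one k H a) (Tens.one k H b) (Tens.one k H c)) := by
  rw [rightTriple, Tens.mk_eq_smul_map F, Tens.mk_eq_smul_map G, Tens.mk_eq_smul_map K,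
    expanded_smul_smul, expanded_smul_smul, expanded_map_map, expanded_map_map, Tens.perm_smul,
    Pow.perm_finAssoc, Tens.perm_map _ _ _ (iterComulTriple_comp_iterComul p q r)
      (perm_finAssoc_comp_tensorHom p q r)]
  rfl

/-- Both sides are additive in each argument, and on generators both are the same `tripleMap`
applied to the corresponding product of elements of `P`. -/
theorem leftTriple_eq_rightTriple
    (h : ∀ a b c : P, μ.leftTriple (Tens.one k H a) (Tens.one k H b) (Tens.one k H c) =
      μ.rightTriple (Tens.one k H a) (Tens.one k H b) (Tens.one k H c))
    {p q r : ℕ} (x : Tens k H P p) (y : Tens k H P q) (z : Tens k H P r) :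
    μ.leftTriple x y z = μ.rightTriple x y z := by
  refine Tens.induction₃ (motive := fun x y z => μ.leftTriple x y z = μ.rightTriple x y z) x y z
    (fun F a G b K c => ?_) (fun x x' y z h h' => ?_) (fun x x' y z h h' => ?_)
    (fun x x' y z h h' => ?_)
  · rw [leftTriple_mk, rightTriple_mk, h]
  all_goals
    simp only [leftTriple, rightTriple, map_add, LinearMap.add_apply] at h h' ⊢
    rw [h, h']

theorem leftTriple_add_flip₁₂
    (h : ∀ a b c : P, μ.leftTriple (Tens.one k H a) (Tens.one k H b) (Tens.one k H c) +
        Tens.perm (finFlip₁₂ 1 1 1)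
          (μ.leftTriple (Tens.one k H b) (Tens.one k H a) (Tens.one k H c)) =
      μ.rightTriple (Tens.one k H a) (Tens.one k H b) (Tens.one k H c) +
        Tens.perm (finFlip₁₂ 1 1 1)
          (μ.rightTriple (Tens.one k H b) (Tens.one k H a) (Tens.one k H c)))
    {p q r : ℕ} (x : Tens k H P p) (y : Tens k H P q) (z : Tens k H P r) :
    μ.leftTriple x y z + Tens.perm (finFlip₁₂ q p r) (μ.leftTriple y x z) =
      μ.rightTriple x y z + Tens.perm (finFlip₁₂ q p r) (μ.rightTriple y x z) := by
  refine Tens.induction₃ (motive := fun {p q r} x y z =>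
    μ.leftTriple x y z + Tens.perm (finFlip₁₂ q p r) (μ.leftTriple y x z) =
      μ.rightTriple x y z + Tens.perm (finFlip₁₂ q p r) (μ.rightTriple y x z)) x y z
    (fun F a G b K c => ?_) (fun x x' y z h h' => ?_) (fun x x' y z h h' => ?_)
    (fun x x' y z h h' => ?_)
  -- The block flip turns `tripleMap G F K` into `tripleMap F G K` of the single flip, so all four
  -- terms come from one additive map.
  · rw [leftTriple_mk μ F G K, leftTriple_mk μ G F K, rightTriple_mk μ F G K,
      rightTriple_mk μ G F K, perm_finFlip₁₂_tripleMap, perm_finFlip₁₂_tripleMap,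
      ← tripleMap_add, ← tripleMap_add, h]
  all_goals
    simp only [leftTriple, rightTriple, map_add, LinearMap.add_apply] at h h' ⊢
    rw [add_add_add_comm, h, h', add_add_add_comm]

theorem rightTriple_add_flip₂₃
    (h : ∀ a b c : P, μ.rightTriple (Tens.one k H a) (Tens.one k H b) (Tens.one k H c) +
        Tens.perm (finFlip₂₃ 1 1 1)
          (μ.rightTriple (Tens.one k H a) (Tens.one k H c) (Tens.one k H b)) =
      μ.leftTriple (Tens.one k H a) (Tens.one k H b) (Tens.one k H c) +
        Tens.perm (finFlip₂₃ 1 1 1)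
          (μ.leftTriple (Tens.one k H a) (Tens.one k H c) (Tens.one k H b)))
    {p q r : ℕ} (x : Tens k H P p) (y : Tens k H P q) (z : Tens k H P r) :
    μ.rightTriple x y z + Tens.perm (finFlip₂₃ p r q) (μ.rightTriple x z y) =
      μ.leftTriple x y z + Tens.perm (finFlip₂₃ p r q) (μ.leftTriple x z y) := by
  refine Tens.induction₃ (motive := fun {p q r} x y z =>
    μ.rightTriple x y z + Tens.perm (finFlip₂₃ p r q) (μ.rightTriple x z y) =
      μ.leftTriple x y z + Tens.perm (finFlip₂₃ p r q) (μ.leftTriple x z y)) x y z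
    (fun F a G b K c => ?_) (fun x x' y z h h' => ?_) (fun x x' y z h h' => ?_)
    (fun x x' y z h h' => ?_)
  · rw [leftTriple_mk μ F G K, leftTriple_mk μ F K G, rightTriple_mk μ F G K,
      rightTriple_mk μ F K G, perm_finFlip₂₃_tripleMap, perm_finFlip₂₃_tripleMap,
      ← tripleMap_add, ← tripleMap_add, h]
  all_goals
    simp only [leftTriple, rightTriple, map_add, LinearMap.add_apply] at h h' ⊢
    rw [add_add_add_comm, h, h', add_add_add_comm]

end Perm

end Pseudoproduct

end Pseudoalgebra

/-! ### Words and brackets in the free non-associative algebra -/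

section Words

variable {k X : Type*} [Field k]

variable (k) in
/-- A non-associative word as an element of the free algebra. -/
def word (w : FreeMagma X) : FreeNonUnitalNonAssocAlgebra k X := MonoidAlgebra.single w 1

theorem word_mul (s t : FreeMagma X) : word k (s.mul t) = word k s * word k t := by
  rw [word, word, word, MonoidAlgebra.single_mul_single, one_mul, FreeMagma.mul_eq]

@[elab_as_elim]
theorem word_induction {motive : FreeNonUnitalNonAssocAlgebra k X → Prop}
    (f : FreeNonUnitalNonAssocAlgebra k X) (zero : motive 0) (word : ∀ w, motive (word k w))
    (smul : ∀ (c : k) f, motive f → motive (c • f))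
    (add : ∀ f g, motive f → motive g → motive (f + g)) : motive f := by
  induction f using MonoidAlgebra.induction_linear with
  | zero => exact zero
  | add f g hf hg => exact add f g hf hg
  | single w c =>
    have h := smul c _ (word w)
    rwa [Pseudo.word, MonoidAlgebra.smul_single, smul_eq_mul, mul_one] at h

/-- The word with every product `s t` replaced by `s t + ε t s`. -/
def bracketWord (ε : k) : FreeMagma X → FreeNonUnitalNonAssocAlgebra k X
  | .of x => word k (.of x)
  | .mul s t => bracketWord ε s * bracketWord ε t + ε • (bracketWord ε t * bracketWord ε s)

/-- The linear extension of `bracketWord`. -/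
def bracket (ε : k) : FreeNonUnitalNonAssocAlgebra k X →ₗ[k] FreeNonUnitalNonAssocAlgebra k X :=
  (Finsupp.linearCombination k (bracketWord ε)) ∘ₗ
    (MonoidAlgebra.coeffLinearEquiv k).toLinearMap

theorem bracket_word (ε : k) (w : FreeMagma X) : bracket ε (word k w) = bracketWord ε w := by
  simp [bracket, word]

theorem bracket_of (ε : k) (x : X) :
    bracket ε (FreeNonUnitalNonAssocAlgebra.of k x) = FreeNonUnitalNonAssocAlgebra.of k x :=
  bracket_word ε (.of x)

/-- With `bracket_of`, this makes `bracket ε` the letter-fixing homomorphism from the free algebra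
to the same space with product `f g + ε g f`. -/
theorem bracket_mul (ε : k) (f g : FreeNonUnitalNonAssocAlgebra k X) :
    bracket ε (f * g) = bracket ε f * bracket ε g + ε • (bracket ε g * bracket ε f) := by
  induction f using word_induction with
  | zero => simp
  | add f f' h h' => simp only [add_mul, mul_add, map_add, h, h', smul_add]; abel
  | smul c f h =>
    simp only [smul_mul_assoc, mul_smul_comm, map_smul, h, smul_add, smul_comm ε]
  | word s =>
  induction g using word_induction with
  | zero => simp
  | add f f' h h' => simp only [add_mul, mul_add, map_add, h, h', smul_add]; abel
  | smul c f h =>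
    simp only [smul_mul_assoc, mul_smul_comm, map_smul, h, smul_add, smul_comm ε]
  | word t => rw [← word_mul, bracket_word, bracket_word, bracket_word, bracketWord]

end Words

/-! ### Values of free-algebra elements and the null ideal. -/

section Pseudoalgebra

variable {k H P : Type*} [Field k] [Ring H] [Bialgebra k H] [Coalgebra.IsCocomm k H]
  [AddCommGroup P] [Module k P] [Module H P]

namespace Pseudoproduct

variable (μ : Pseudoproduct k H P)

section Span

variable {X : Type*} (a : X → P)

/-- `μ.Represents a ℓ f x` says that `x` is a value of the element `f` of the free algebra, where
the words involved are rearrangements of the sequence of letters `ℓ`, and the tensor factors are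
ordered as in `ℓ`. -/
inductive Represents {m : ℕ} (ℓ : Fin m → X) :
    FreeNonUnitalNonAssocAlgebra k X → Tens k H P m → Prop
  | zero : Represents ℓ 0 0
  | add {f g x y} : Represents ℓ f x → Represents ℓ g y → Represents ℓ (f + g) (x + y)
  | smul (c : k) {f x} : Represents ℓ f x → Represents ℓ (c • f) (c • x)
  | word (w : FreeMagma X) (e : Fin w.length ≃ Fin m) (he : ∀ i, ℓ (e i) = leaf w i) :
      Represents ℓ (word k w) (Tens.perm e (μ.evalWord a w))

theorem represents_word (w : FreeMagma X) :
    μ.Represents a (leaf w) (word k w) (μ.evalWord a w) := by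
  have h := Represents.word (μ := μ) (a := a) (ℓ := leaf w) w (Equiv.refl _) fun _ => rfl
  rwa [Tens.perm_refl] at h

variable {μ a}

theorem Represents.sub {m : ℕ} {ℓ : Fin m → X} {f g : FreeNonUnitalNonAssocAlgebra k X}
    {x y : Tens k H P m} (hf : μ.Represents a ℓ f x) (hg : μ.Represents a ℓ g y) :
    μ.Represents a ℓ (f - g) (x - y) := by
  have h := hf.add (hg.smul (-1))
  rwa [neg_one_smul, neg_one_smul, ← sub_eq_add_neg, ← sub_eq_add_neg] at h

theorem Represents.perm {m m' : ℕ} {ℓ : Fin m → X} {ℓ' : Fin m' → X} {e : Fin m ≃ Fin m'}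
    (he : ∀ i, ℓ' (e i) = ℓ i) {f : FreeNonUnitalNonAssocAlgebra k X} {x : Tens k H P m}
    (h : μ.Represents a ℓ f x) : μ.Represents a ℓ' f (Tens.perm e x) := by
  induction h with
  | zero => rw [map_zero]; exact .zero
  | add _ _ h₁ h₂ => rw [map_add]; exact h₁.add h₂
  | smul c _ h => rw [map_smul]; exact h.smul c
  | word w d hd =>
    rw [Tens.perm_perm]
    exact .word w _ fun i => by rw [Equiv.trans_apply, he, hd]

/-- By bilinearity this reduces to words, where the two rearrangements combine into their block sum.
It is the reason null elements form an ideal. -/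
theorem Represents.mul {m m' : ℕ} {ℓ : Fin m → X} {ℓ' : Fin m' → X}
    {f g : FreeNonUnitalNonAssocAlgebra k X} {x : Tens k H P m} {y : Tens k H P m'}
    (hx : μ.Represents a ℓ f x) (hy : μ.Represents a ℓ' g y) :
    μ.Represents a (Fin.append ℓ ℓ') (f * g) (μ.expanded m m' x y) := by
  induction hx with
  | zero => rw [zero_mul, map_zero, LinearMap.zero_apply]; exact .zero
  | add _ _ h₁ h₂ => rw [add_mul, map_add, LinearMap.add_apply]; exact h₁.add h₂
  | smul c _ h => rw [smul_mul_assoc, map_smul, LinearMap.smul_apply]; exact h.smul c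
  | word s d hd =>
  induction hy with
  | zero => rw [mul_zero, map_zero]; exact .zero
  | add _ _ h₁ h₂ => rw [mul_add, map_add]; exact h₁.add h₂
  | smul c _ h => rw [mul_smul_comm, map_smul]; exact h.smul c
  | word t e he =>
  rw [← word_mul, expanded_perm_perm]
  exact .word (s.mul t) (finSumCongr d e) (append_comp_finSumCongr _ _ d e hd he)

theorem Represents.leftTriple {p q r : ℕ} {ℓ₁ : Fin p → X} {ℓ₂ : Fin q → X} {ℓ₃ : Fin r → X}
    {f g h : FreeNonUnitalNonAssocAlgebra k X} {x : Tens k H P p} {y : Tens k H P q}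
    {z : Tens k H P r} (hx : μ.Represents a ℓ₁ f x) (hy : μ.Represents a ℓ₂ g y)
    (hz : μ.Represents a ℓ₃ h z) :
    μ.Represents a (Fin.append (Fin.append ℓ₁ ℓ₂) ℓ₃) (f * g * h) (μ.leftTriple x y z) :=
  (hx.mul hy).mul hz

theorem Represents.rightTriple {p q r : ℕ} {ℓ₁ : Fin p → X} {ℓ₂ : Fin q → X} {ℓ₃ : Fin r → X}
    {f g h : FreeNonUnitalNonAssocAlgebra k X} {x : Tens k H P p} {y : Tens k H P q}
    {z : Tens k H P r} (hx : μ.Represents a ℓ₁ f x) (hy : μ.Represents a ℓ₂ g y)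
    (hz : μ.Represents a ℓ₃ h z) :
    μ.Represents a (Fin.append (Fin.append ℓ₁ ℓ₂) ℓ₃) (f * (g * h))
      (μ.rightTriple x y z) :=
  (hx.mul (hy.mul hz)).perm (append_comp_finAssoc ℓ₁ ℓ₂ ℓ₃)

/-- Induction on the word: in the flipped summand of a product, the block flip of tensor factors
matches the exchange of the two letter sequences. -/
theorem represents_bracketWord {ν : Pseudoproduct k H P} {ε : k}
    (h : ∀ a b, ν.mul a b = μ.mul a b + ε • swap₁₂ (μ.mul b a)) (w : FreeMagma X) :
    μ.Represents a (leaf w) (bracketWord ε w) (ν.evalWord a w) := by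
  induction w using FreeMagma.rec with
  | of x => exact μ.represents_word a (.of x)
  | mul s t hs ht =>
    have h₁ : ν.evalWord a (s.mul t) =
        ν.expanded s.length t.length (ν.evalWord a s) (ν.evalWord a t) := rfl
    rw [h₁, expanded_eq_add_flip μ h, bracketWord]
    exact (hs.mul ht).add (((ht.mul hs).perm (append_comp_finAddFlip _ _)).smul ε)

variable (μ a) in
/-- The elements of the free algebra whose value vanishes, before the letters are identified with
tensor factors, and their linear combinations. -/
def nullSubmodule : Submodule k (FreeNonUnitalNonAssocAlgebra k X) :=
  Submodule.span k {f | ∃ (m : ℕ) (ℓ : Fin m → X), μ.Represents a ℓ f (0 : Tens k H P m)}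

theorem mem_nullSubmodule {m : ℕ} {ℓ : Fin m → X} {f : FreeNonUnitalNonAssocAlgebra k X}
    {x : Tens k H P m} (hf : μ.Represents a ℓ f x) (hx : x = 0) : f ∈ μ.nullSubmodule a :=
  Submodule.subset_span ⟨m, ℓ, hx ▸ hf⟩

/-- The other factor may be taken to be a word, which represents its own value; the product then
represents that value times zero. -/
theorem mul_mem_nullSubmodule_left {f g : FreeNonUnitalNonAssocAlgebra k X}
    (hg : g ∈ μ.nullSubmodule a) : f * g ∈ μ.nullSubmodule a := by
  induction f using word_induction with
  | zero => simp
  | add f f' h h' => rw [add_mul]; exact add_mem h h'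
  | smul c f h => rw [smul_mul_assoc]; exact Submodule.smul_mem _ c h
  | word w =>
  induction hg using Submodule.span_induction with
  | zero => rw [mul_zero]; exact zero_mem _
  | add f f' _ _ h h' => rw [mul_add]; exact add_mem h h'
  | smul c f _ h => rw [mul_smul_comm]; exact Submodule.smul_mem _ c h
  | mem g hg =>
  obtain ⟨m, ℓ, hg⟩ := hg
  exact Submodule.subset_span
    ⟨_, _, by simpa using (μ.represents_word a w).mul hg⟩

theorem mul_mem_nullSubmodule_right {f g : FreeNonUnitalNonAssocAlgebra k X}
    (hf : f ∈ μ.nullSubmodule a) : f * g ∈ μ.nullSubmodule a := by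
  induction g using word_induction with
  | zero => simp
  | add f f' h h' => rw [mul_add]; exact add_mem h h'
  | smul c f h => rw [mul_smul_comm]; exact Submodule.smul_mem _ c h
  | word w =>
  induction hf using Submodule.span_induction with
  | zero => rw [zero_mul]; exact zero_mem _
  | add f f' _ _ h h' => rw [add_mul]; exact add_mem h h'
  | smul c f _ h => rw [smul_mul_assoc]; exact Submodule.smul_mem _ c h
  | mem g hg =>
  obtain ⟨m, ℓ, hg⟩ := hg
  exact Submodule.subset_span
    ⟨_, _, by simpa using hg.mul (μ.represents_word a w)⟩

variable (μ a) in
/-- `nullSubmodule` as a two-sided ideal. -/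
def nullIdeal : TwoSidedIdeal (FreeNonUnitalNonAssocAlgebra k X) :=
  TwoSidedIdeal.mk' (μ.nullSubmodule a) (zero_mem _) add_mem neg_mem mul_mem_nullSubmodule_left
    mul_mem_nullSubmodule_right

theorem mem_nullIdeal {f : FreeNonUnitalNonAssocAlgebra k X} :
    f ∈ μ.nullIdeal a ↔ f ∈ μ.nullSubmodule a :=
  TwoSidedIdeal.mem_mk' ..

theorem mk_eq_mk_iff {f g : FreeNonUnitalNonAssocAlgebra k X} :
    (f : (μ.nullIdeal a).ringCon.Quotient) = g ↔ f - g ∈ μ.nullSubmodule a := by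
  rw [RingCon.eq, TwoSidedIdeal.rel_iff, mem_nullIdeal]

theorem trilinear_mem_of_word {N : Submodule k (FreeNonUnitalNonAssocAlgebra k X)}
    {D : FreeNonUnitalNonAssocAlgebra k X → FreeNonUnitalNonAssocAlgebra k X →
      FreeNonUnitalNonAssocAlgebra k X → FreeNonUnitalNonAssocAlgebra k X}
    (h₁ : ∀ g h, IsLinearMap k fun f => D f g h) (h₂ : ∀ f h, IsLinearMap k fun g => D f g h)
    (h₃ : ∀ f g, IsLinearMap k fun h => D f g h)
    (hw : ∀ u v w, D (word k u) (word k v) (word k w) ∈ N)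
    (f g h : FreeNonUnitalNonAssocAlgebra k X) : D f g h ∈ N := by
  induction f using word_induction with
  | zero => rw [(h₁ g h).map_zero]; exact zero_mem _
  | add f f' hf hf' => rw [(h₁ g h).map_add]; exact add_mem hf hf'
  | smul c f hf => rw [(h₁ g h).map_smul]; exact Submodule.smul_mem _ c hf
  | word u =>
  induction g using word_induction with
  | zero => rw [(h₂ _ h).map_zero]; exact zero_mem _
  | add f f' hf hf' => rw [(h₂ _ h).map_add]; exact add_mem hf hf'
  | smul c f hf => rw [(h₂ _ h).map_smul]; exact Submodule.smul_mem _ c hf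
  | word v =>
  induction h using word_induction with
  | zero => rw [(h₃ _ _).map_zero]; exact zero_mem _
  | add f f' hf hf' => rw [(h₃ _ _).map_add]; exact add_mem hf hf'
  | smul c f hf => rw [(h₃ _ _).map_smul]; exact Submodule.smul_mem _ c hf
  | word w => exact hw u v w

/-! ### The three-variable laws for represented values. -/

section Triples

variable {p q r : ℕ} {ℓ₁ : Fin p → X} {ℓ₂ : Fin q → X} {ℓ₃ : Fin r → X}
  {f g h : FreeNonUnitalNonAssocAlgebra k X} {x : Tens k H P p} {y : Tens k H P q}
  {z : Tens k H P r}

theorem Represents.assoc (hx : μ.Represents a ℓ₁ f x) (hy : μ.Represents a ℓ₂ g y)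
    (hz : μ.Represents a ℓ₃ h z) :
    μ.Represents a (Fin.append (Fin.append ℓ₁ ℓ₂) ℓ₃) (f * g * h - f * (g * h))
      (μ.leftTriple x y z - μ.rightTriple x y z) :=
  (hx.leftTriple hy hz).sub (hx.rightTriple hy hz)

theorem Represents.leftAlt (hx : μ.Represents a ℓ₁ f x) (hy : μ.Represents a ℓ₂ g y)
    (hz : μ.Represents a ℓ₃ h z) :
    μ.Represents a (Fin.append (Fin.append ℓ₁ ℓ₂) ℓ₃)
      (f * g * h + g * f * h - (f * (g * h) + g * (f * h)))
      (μ.leftTriple x y z + Tens.perm (finFlip₁₂ q p r) (μ.leftTriple y x z) -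
        (μ.rightTriple x y z + Tens.perm (finFlip₁₂ q p r) (μ.rightTriple y x z))) :=
  have he := append_comp_finFlip₁₂ ℓ₁ ℓ₂ ℓ₃
  ((hx.leftTriple hy hz).add ((hy.leftTriple hx hz).perm he)).sub
    ((hx.rightTriple hy hz).add ((hy.rightTriple hx hz).perm he))

theorem Represents.rightAlt (hx : μ.Represents a ℓ₁ f x) (hy : μ.Represents a ℓ₂ g y)
    (hz : μ.Represents a ℓ₃ h z) :
    μ.Represents a (Fin.append (Fin.append ℓ₁ ℓ₂) ℓ₃)
      (f * (g * h) + f * (h * g) - (f * g * h + f * h * g))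
      (μ.rightTriple x y z + Tens.perm (finFlip₂₃ p r q) (μ.rightTriple x z y) -
        (μ.leftTriple x y z + Tens.perm (finFlip₂₃ p r q) (μ.leftTriple x z y))) :=
  have he := append_comp_finFlip₂₃ ℓ₁ ℓ₂ ℓ₃
  ((hx.rightTriple hy hz).add ((hx.rightTriple hz hy).perm he)).sub
    ((hx.leftTriple hy hz).add ((hx.leftTriple hz hy).perm he))

end Triples

end Span

/-! ### From represented values to `starEval`. -/

section Star

variable {n : ℕ} (a : Fin n → P)

open Classical in
/-- Moves the tensor factor belonging to the letter `x_i` to position `i`, when every letter occurs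
exactly once. -/
def arrange {m : ℕ} (ℓ : Fin m → Fin n) : Tens k H P m →ₗ[k] Tens k H P n :=
  if h : Function.Bijective ℓ then Tens.perm (Equiv.ofBijective ℓ h) else 0

theorem starWord_eq_arrange (w : FreeMagma (Fin n)) :
    μ.starWord a w = arrange (leaf w) (μ.evalWord a w) := by
  unfold starWord arrange
  split_ifs <;> rfl

theorem arrange_perm {m m' : ℕ} {ℓ : Fin m → Fin n} {ℓ' : Fin m' → Fin n} (e : Fin m ≃ Fin m')
    (h : ∀ i, ℓ' (e i) = ℓ i) (x : Tens k H P m) :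
    arrange ℓ' (Tens.perm e x) = arrange ℓ x := by
  obtain rfl : ℓ' ∘ e = ℓ := funext h
  unfold arrange
  by_cases hb : Function.Bijective ℓ'
  · rw [dif_pos hb, dif_pos (hb.comp e.bijective), Tens.perm_perm]
    exact congrArg (fun e => Tens.perm e x) (Equiv.ext fun _ => rfl)
  · rw [dif_neg hb, dif_neg (mt (Function.Bijective.of_comp_iff ℓ' e.bijective).1 hb)]
    rfl

theorem starEval_word (w : FreeMagma (Fin n)) : μ.starEval a (word k w) = μ.starWord a w := by
  simp [starEval, word]

variable {μ a}

/-- Arranging factors by their letters forgets any previous letter-preserving permutation. When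
letters repeat or are missing, a represented tensor need not be determined by `f`, but then both
sides are `0`. -/
theorem starEval_eq_arrange {m : ℕ} {ℓ : Fin m → Fin n} {f : FreeNonUnitalNonAssocAlgebra k (Fin n)}
    {x : Tens k H P m} (h : μ.Represents a ℓ f x) : μ.starEval a f = arrange ℓ x := by
  induction h with
  | zero => rw [map_zero, map_zero]
  | add _ _ h₁ h₂ => rw [map_add, map_add, h₁, h₂]
  | smul c _ h => rw [map_smul, map_smul, h]
  | word w d hd => rw [arrange_perm d hd, starEval_word, starWord_eq_arrange]

theorem starEval_eq_zero {f : FreeNonUnitalNonAssocAlgebra k (Fin n)}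
    (h : f ∈ μ.nullSubmodule a) : μ.starEval a f = 0 := by
  suffices h' : μ.nullSubmodule a ≤ LinearMap.ker (μ.starEval a) from h' h
  refine Submodule.span_le.2 ?_
  rintro f ⟨m, ℓ, h⟩
  exact (starEval_eq_arrange h).trans (map_zero _)

theorem starEval_bracket {ν : Pseudoproduct k H P} {ε : k}
    (h : ∀ a b, ν.mul a b = μ.mul a b + ε • swap₁₂ (μ.mul b a))
    (f : FreeNonUnitalNonAssocAlgebra k (Fin n)) :
    ν.starEval a f = μ.starEval a (bracket ε f) := by
  induction f using word_induction with
  | zero => simp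
  | add f g hf hg => simp only [map_add, hf, hg]
  | smul c f h => simp only [map_smul, h]
  | word w =>
    rw [bracket_word, starEval_word, starWord_eq_arrange,
      starEval_eq_arrange (represents_bracketWord h w)]

end Star

end Pseudoproduct

end Pseudoalgebra

/-! ### Transfer of the laws to the quotient and back. -/

section Pseudoalgebra

variable {k H P : Type*} [Field k] [Ring H] [Bialgebra k H] [Coalgebra.IsCocomm k H]
  [AddCommGroup P] [Module k P] [Module H P]

theorem Tens.perm_injective {m n : ℕ} (e : Fin m ≃ Fin n) :
    Function.Injective (Tens.perm (k := k) (H := H) (P := P) e) :=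
  Function.LeftInverse.injective (g := Tens.perm e.symm) fun x => by
    rw [Tens.perm_perm, Equiv.self_trans_symm, Tens.perm_refl]

namespace Pseudoproduct

variable {μ : Pseudoproduct k H P}

theorem arrange_injective {m n : ℕ} {ℓ : Fin m → Fin n} (h : Function.Bijective ℓ) :
    Function.Injective (arrange (k := k) (H := H) (P := P) ℓ) := by
  rw [arrange, dif_pos h]
  exact Tens.perm_injective _

/-- When each letter occurs once, arranging is a permutation of factors and loses nothing, so a
pseudo-identity can be read before rearrangement. -/
theorem Satisfies.eq_zero {n m : ℕ} {f : Poly k n} (hf : μ.Satisfies f) {a : Fin n → P}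
    {ℓ : Fin m → Fin n} (hℓ : Function.Bijective ℓ) {x : Tens k H P m}
    (h : μ.Represents a ℓ f x) : x = 0 :=
  arrange_injective hℓ (by rw [← starEval_eq_arrange h, hf a, map_zero])

theorem represents_X (μ : Pseudoproduct k H P) {n : ℕ} (a : Fin n → P) (i : Fin n) :
    μ.Represents a (fun _ : Fin 1 => i) (X k i) (Tens.one k H (a i)) :=
  μ.represents_word a (.of i)

theorem bijective_append_three : Function.Bijective
    (Fin.append (Fin.append (fun _ : Fin 1 => (0 : Fin 3)) (fun _ : Fin 1 => 1))
      (fun _ : Fin 1 => 2)) := by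
  decide

theorem IsAssociative.leftTriple_eq (h : μ.IsAssociative) {p q r : ℕ} (x : Tens k H P p)
    (y : Tens k H P q) (z : Tens k H P r) : μ.leftTriple x y z - μ.rightTriple x y z = 0 :=
  -- The assumed identity is used at three elements of `P` only; `leftTriple_eq_rightTriple` extends
  -- it to tensors.
  sub_eq_zero.2 <| μ.leftTriple_eq_rightTriple (fun a b c => sub_eq_zero.1 <|
    Satisfies.eq_zero h bijective_append_three
      ((μ.represents_X ![a, b, c] 0).assoc (μ.represents_X ![a, b, c] 1)
        (μ.represents_X ![a, b, c] 2))) x y z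

theorem IsAlternative.left (h : μ.IsAlternative) {p q r : ℕ} (x : Tens k H P p)
    (y : Tens k H P q) (z : Tens k H P r) :
    μ.leftTriple x y z + Tens.perm (finFlip₁₂ q p r) (μ.leftTriple y x z) -
      (μ.rightTriple x y z + Tens.perm (finFlip₁₂ q p r) (μ.rightTriple y x z)) = 0 :=
  sub_eq_zero.2 <| μ.leftTriple_add_flip₁₂ (fun a b c => sub_eq_zero.1 <|
    Satisfies.eq_zero h.1 bijective_append_three
      ((μ.represents_X ![a, b, c] 0).leftAlt (μ.represents_X ![a, b, c] 1)
        (μ.represents_X ![a, b, c] 2))) x y z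

theorem IsAlternative.right (h : μ.IsAlternative) {p q r : ℕ} (x : Tens k H P p)
    (y : Tens k H P q) (z : Tens k H P r) :
    μ.rightTriple x y z + Tens.perm (finFlip₂₃ p r q) (μ.rightTriple x z y) -
      (μ.leftTriple x y z + Tens.perm (finFlip₂₃ p r q) (μ.leftTriple x z y)) = 0 :=
  sub_eq_zero.2 <| μ.rightTriple_add_flip₂₃ (fun a b c => sub_eq_zero.1 <|
    Satisfies.eq_zero h.2 bijective_append_three
      ((μ.represents_X ![a, b, c] 0).rightAlt (μ.represents_X ![a, b, c] 1)
        (μ.represents_X ![a, b, c] 2))) x y z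

section Quotient

/-- The quotient of the free algebra by the null ideal. -/
abbrev evalAlgebra (μ : Pseudoproduct k H P) {X : Type*} (a : X → P) : Type _ :=
  (μ.nullIdeal a).ringCon.Quotient

variable {X : Type*} (a : X → P)

/-- By trilinearity only words matter. The associator of three words represents the associator of
their values, which vanishes for words of any length, with letters possibly repeated. -/
theorem IsAssociative.evalAlgebra_assoc (h : μ.IsAssociative) (x y z : μ.evalAlgebra a) :
    x * y * z = x * (y * z) := by
  obtain ⟨x, rfl⟩ := Quotient.exists_rep x
  obtain ⟨y, rfl⟩ := Quotient.exists_rep y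
  obtain ⟨z, rfl⟩ := Quotient.exists_rep z
  refine mk_eq_mk_iff.2 ?_
  refine trilinear_mem_of_word (D := fun x y z => x * y * z - x * (y * z)) (fun g h => ?_)
    (fun g h => ?_) (fun g h => ?_) (fun u v w => ?_) x y z
  rotate_right
  · exact mem_nullSubmodule ((μ.represents_word a u).assoc (μ.represents_word a v)
        (μ.represents_word a w)) (h.leftTriple_eq _ _ _)
  all_goals
    constructor
    · intros; simp only [add_mul, mul_add]; abel
    · intros; simp only [smul_mul_assoc, mul_smul_comm, smul_sub]

theorem IsAlternative.evalAlgebra_alternative (h : μ.IsAlternative) :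
    IsAlternativeAlgebra (μ.evalAlgebra a) := by
  constructor
  all_goals
    intro x y z
    obtain ⟨x, rfl⟩ := Quotient.exists_rep x
    obtain ⟨y, rfl⟩ := Quotient.exists_rep y
    obtain ⟨z, rfl⟩ := Quotient.exists_rep z
    refine mk_eq_mk_iff.2 ?_
  · refine trilinear_mem_of_word
      (D := fun x y z => x * y * z + y * x * z - (x * (y * z) + y * (x * z))) (fun g h => ?_)
      (fun g h => ?_) (fun g h => ?_) (fun u v w => ?_) x y z
    rotate_right
    · exact mem_nullSubmodule ((μ.represents_word a u).leftAlt (μ.represents_word a v)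
        (μ.represents_word a w)) (h.left _ _ _)
    all_goals
      constructor
      · intros; simp only [add_mul, mul_add]; abel
      · intros; simp only [smul_mul_assoc, mul_smul_comm, smul_sub, smul_add]
  · refine trilinear_mem_of_word
      (D := fun x y z => x * (y * z) + x * (z * y) - (x * y * z + x * z * y)) (fun g h => ?_)
      (fun g h => ?_) (fun g h => ?_) (fun u v w => ?_) x y z
    rotate_right
    · exact mem_nullSubmodule ((μ.represents_word a u).rightAlt (μ.represents_word a v)
        (μ.represents_word a w)) (h.right _ _ _)
    all_goals
      constructor
      · intros; simp only [add_mul, mul_add]; abel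
      · intros; simp only [smul_mul_assoc, mul_smul_comm, smul_sub, smul_add]

end Quotient

/-- The transfer principle: an identity of the deformed product follows once its expansion vanishes
on the classes of the variables in the quotient ring. -/
theorem satisfies_of_bracket {ν : Pseudoproduct k H P} {ε : k}
    (h : ∀ a b, ν.mul a b = μ.mul a b + ε • swap₁₂ (μ.mul b a)) {n : ℕ} {f : Poly k n}
    (hf : ∀ a : Fin n → P, (bracket ε f : μ.evalAlgebra a) = (0 : Poly k n)) : ν.Satisfies f :=
  fun a => by
    rw [starEval_bracket h]
    exact starEval_eq_zero (by simpa using mk_eq_mk_iff.1 (hf a))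

theorem minus_mul_eq (μ : Pseudoproduct k H P) (a b : P) :
    μ.minus.mul a b = μ.mul a b + (-1 : k) • swap₁₂ (μ.mul b a) := by
  rw [minus_mul, neg_one_smul, sub_eq_add_neg]

theorem plus_mul_eq (μ : Pseudoproduct k H P) (a b : P) :
    μ.plus.mul a b = μ.mul a b + (1 : k) • swap₁₂ (μ.mul b a) := by
  rw [plus_mul, one_smul]

theorem bracket_neg_one_mul {Y : Type*} (f g : FreeNonUnitalNonAssocAlgebra k Y) :
    bracket (-1 : k) (f * g) = commProd (bracket (-1) f) (bracket (-1) g) := by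
  rw [bracket_mul, neg_one_smul, ← sub_eq_add_neg, commProd]

theorem bracket_one_mul {Y : Type*} (f g : FreeNonUnitalNonAssocAlgebra k Y) :
    bracket (1 : k) (f * g) = jordanProd (bracket 1 f) (bracket 1 g) := by
  rw [bracket_mul, one_smul, jordanProd]

theorem minus_anticomm (μ : Pseudoproduct k H P) : μ.minus.Satisfies (anticommPoly k) :=
  satisfies_of_bracket μ.minus_mul_eq fun a => by
    rw [anticommPoly, map_add, bracket_neg_one_mul, bracket_neg_one_mul, commProd, commProd]
    -- The expansion is already zero in the free algebra, so no property of `μ` is needed.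
    congr 1
    abel

theorem plus_comm (μ : Pseudoproduct k H P) : μ.plus.Satisfies (commPoly k) :=
  satisfies_of_bracket μ.plus_mul_eq fun a => by
    rw [commPoly, map_sub, bracket_one_mul, bracket_one_mul, jordanProd, jordanProd]
    congr 1
    abel

theorem minus_jacobi (h : μ.IsAssociative) : μ.minus.Satisfies (jacobiPoly k) :=
  satisfies_of_bracket μ.minus_mul_eq fun a => by
    simp only [jacobiPoly, jacobian, map_add, map_sub, bracket_neg_one_mul, bracket_of]
    -- Operations in the quotient are computed on representatives, so the class of the expansion is
    -- definitionally the commutator Jacobian of the classes of the variables.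
    exact commJacobian_eq_zero (h.evalAlgebra_assoc a) (X k 0 : Poly k 3) (X k 1 : Poly k 3)
      (X k 2 : Poly k 3)

theorem minus_malcev (h : ∀ a : Fin 4 → P, IsAlternativeAlgebra (μ.evalAlgebra a)) :
    μ.minus.Satisfies (malcevPoly k) :=
  satisfies_of_bracket μ.minus_mul_eq fun a => by
    simp only [malcevPoly, jacobian, map_add, map_sub, bracket_neg_one_mul, bracket_of]
    exact sub_eq_zero.2 ((h a).malcev (X k 0 : Poly k 4) (X k 1 : Poly k 4) (X k 2 : Poly k 4)
      (X k 3 : Poly k 4))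

theorem plus_jordan (h : ∀ a : Fin 4 → P, IsAlternativeAlgebra (μ.evalAlgebra a)) :
    μ.plus.Satisfies (jordanPoly k) :=
  satisfies_of_bracket μ.plus_mul_eq fun a => by
    simp only [jordanPoly, map_add, map_sub, bracket_one_mul, bracket_of]
    exact sub_eq_zero.2 ((h a).jordan (X k 0 : Poly k 4) (X k 1 : Poly k 4) (X k 2 : Poly k 4)
      (X k 3 : Poly k 4))

end Pseudoproduct

end Pseudoalgebra

end Pseudo

end

theorem mainTheorem7 {k H P : Type*} [Field k] [CharZero k] [Ring H] [HopfAlgebra k H]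
    [Coalgebra.IsCocomm k H] [AddCommGroup P] [Module k P] [Module H P] [IsScalarTower k H P]
    (μ : Pseudo.Pseudoproduct k H P) :
    (μ.IsAssociative → μ.minus.IsLie ∧ μ.plus.IsJordan) ∧
    (μ.IsAlternative → μ.minus.IsMalcev ∧ μ.plus.IsJordan) :=
  -- The Jordan identity in the associative case is the alternative case, since the associative
  -- quotient ring is alternative.
  ⟨fun h => ⟨⟨μ.minus_anticomm, μ.minus_jacobi h⟩, μ.plus_comm,
      Pseudo.Pseudoproduct.plus_jordan fun a => .of_assoc (h.evalAlgebra_assoc a)⟩,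
    fun h => ⟨⟨μ.minus_anticomm, Pseudo.Pseudoproduct.minus_malcev h.evalAlgebra_alternative⟩,
      μ.plus_comm, Pseudo.Pseudoproduct.plus_jordan h.evalAlgebra_alternative⟩⟩
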